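/- Let $g_1,\dots,g_m$ be linearly independent (over $\mathbb R$) traceless Hermitian operators on $\mathbb{C}^N$, let $0\neq\alpha\in\mathbb{R}^m$ and $t>0$. For a Hermitian operator $G$ let $\|G\|_s=\lambda_{\max}(G)-\lambda_{\min}(G)$, and let $\|A\|_1=\mathrm{Tr}\sqrt{A^\dagger A}$ be the trace norm. Define $$\gamma(g|\alpha)=\min\Big\{\tfrac12\|A\|_1 : A \text{ Hermitian } N\times N,\ \mathrm{Tr}(A)=0,\ \mathrm{Tr}(Ag_j)=\alpha_j\ \ (j=1,\dots,m)\Big\}.$$ Then the following hold. 1. The minimum is attained, $\gamma(g|\alpha)>0$, and $$\gamma(g|\alpha)^{-1}=\min\Big\{\big\|\textstyle\sum_j\beta_jg_j\big\|_s : \beta\in\mathbb{R}^m,\ \alpha\cdot\beta=1\Big\},$$ where this minimum is attained as well. 2. For an orthonormal basis $\mathcal K=\{|k\rangle\}$ of $\mathbb{C}^N$ let $\mathcal A_{\mathcal K}=\{a\in\mathbb R^N : \sum_k a_k\langle k|g_j|k\rangle=\alpha_j\ \forall j,\ \sum_k a_k=0\}$. For every $\mathcal K$ with $\mathcal A_{\mathcal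 K}\ne\varnothing$ the commuting-generator linear program $\min_{a\in\mathcal A_{\mathcal K}}\|a\|_1^2/(4t^2)$ attains its minimum, and $$\frac{\gamma(g|\alpha)^2}{t^2}=\min_{\mathcal K:\ \mathcal A_{\mathcal K}\neq\varnothing}\ \min_{a\in\mathcal A_{\mathcal K}}\frac{\|a\|_1^2}{4t^2},$$ the outer minimum being attained too. 3. Let $\theta\in\mathbb R^m$ be unknown and consider any sensing protocol of total evolution time $t$: a system $\mathbb C^N$ together with an ancilla $\mathbb C^d$ of arbitrary finite dimension is prepared in an arbitrary initial density matrix that does not depend on $\theta$; it evolves under $H(s)=\sum_j\theta_j\,g_j\otimes 1+H_c(s)$, where the control $H_c$ is an arbitrary $\theta$-independent integrable Hermitian-matrix-valued function of time on system and ancilla, possibly with finitely many interleaved instantaneous $\theta$-independent unitary gates; finally an arbitrary $\theta$-independent POVM with outcomes in an arbitrary measurable space is measured. Let $P_\theta$ be the distribution of the outcome, and let $q_{\mathrm{est}}$ be a measurable real function of the outcome that is locally unbiased at $\theta$ for $q(\theta)=\alpha\cdot\theta$: it is $P_{\theta'}$-integrable for all $\theta'$ near $\theta$, $\mathbb E_\theta[q_{\mathrm{est}}]=\alpha\cdot\theta$,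 and at $\theta$ the directional derivative of $\theta'\mapsto\mathbb E_{\theta'}[q_{\mathrm{est}}]$ in every direction $v$ exists and equals $\alpha\cdot v$ (in particular this holds for every estimator that is unbiased near $\theta$). Then $$\mathrm{Var}_\theta(q_{\mathrm{est}})\ \ge\ \frac{\gamma(g|\alpha)^2}{t^2}$$ (where the variance may be $+\infty$). -/

import Mathlib

open MeasureTheory ProbabilityTheory Filter Topology Set
open scoped Matrix Kronecker ComplexOrder

namespace QMetrology

noncomputable section

/-! ### Norms of matrices and the optimization problems -/

open scoped MatrixOrder in
/-- The trace norm `‖A‖₁ = Tr √(A† A)`. -/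
def traceNorm {n : Type*} [Fintype n] [DecidableEq n] (A : Matrix n n ℂ) : ℝ :=
  (CFC.sqrt (Aᴴ * A)).trace.re

/-- The operator seminorm `‖G‖ₛ` of a Hermitian matrix: largest minus smallest eigenvalue. -/
def opSeminorm {n : Type*} [Fintype n] [DecidableEq n] (G : Matrix n n ℂ) : ℝ :=
  sSup (spectrum ℝ G) - sInf (spectrum ℝ G)

/-- The linear combination `β · g = ∑ j, β j g_j`. -/
def lincomb {N m : ℕ} (β : Fin m → ℝ) (g : Fin m → Matrix (Fin N) (Fin N) ℂ) :
    Matrix (Fin N) (Fin N) ℂ :=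
  ∑ j, β j • g j

/-- The feasible set of the trace-norm problem: Hermitian traceless `A` with
`Tr (A g_j) = α_j` for all `j`. -/
def feasible {N m : ℕ} (g : Fin m → Matrix (Fin N) (Fin N) ℂ) (α : Fin m → ℝ) :
    Set (Matrix (Fin N) (Fin N) ℂ) :=
  {A | A.IsHermitian ∧ (∀ j, (A * g j).trace = (α j : ℂ)) ∧ A.trace = 0}

/-- `γ(g|α)`, the optimal value of `‖A‖₁ / 2` over the feasible set. -/
def gamma {N m : ℕ} (g : Fin m → Matrix (Fin N) (Fin N) ℂ) (α : Fin m → ℝ) : ℝ :=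
  sInf ((fun A => traceNorm A / 2) '' feasible g α)

/-- The set `𝒜_K` of the linear program in the orthonormal basis `K`: the real vectors `a` with
`∑ k, a_k ⟨k|g_j|k⟩ = α_j` for all `j` and `∑ k, a_k = 0`. -/
def lpFeasible {N m : ℕ} (g : Fin m → Matrix (Fin N) (Fin N) ℂ) (α : Fin m → ℝ)
    (K : OrthonormalBasis (Fin N) ℂ (EuclideanSpace ℂ (Fin N))) : Set (Fin N → ℝ) :=
  {a | (∀ j, ∑ k, (a k : ℂ) * inner ℂ (K k) (Matrix.toEuclideanLin (g j) (K k)) = (α j : ℂ)) ∧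
    ∑ k, a k = 0}

/-- The values `‖a‖₁² / (4 t²)` of the objective of the linear program in the basis `K`. -/
def lpValues {N m : ℕ} (g : Fin m → Matrix (Fin N) (Fin N) ℂ) (α : Fin m → ℝ) (t : ℝ)
    (K : OrthonormalBasis (Fin N) ℂ (EuclideanSpace ℂ (Fin N))) : Set ℝ :=
  (fun a : Fin N → ℝ => (∑ k, |a k|) ^ 2 / (4 * t ^ 2)) '' lpFeasible g α K

/-! ### Controlled evolution -/

/-- `U` is the propagator on `[0, τ]` of the time-dependent Hamiltonian `H`, that is, the solution
of `U' = -i H U`, `U 0 = 1`, in integrated form (entry by entry). -/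
structure IsPropagator {n : Type*} [Fintype n] [DecidableEq n]
    (H : ℝ → Matrix n n ℂ) (τ : ℝ) (U : ℝ → Matrix n n ℂ) : Prop where
  continuousOn : ContinuousOn U (Icc 0 τ)
  eq_integral : ∀ s ∈ Icc (0 : ℝ) τ, ∀ a b,
    U s a b = (1 : Matrix n n ℂ) a b - Complex.I * ∫ r in (0 : ℝ)..s, (H r * U r) a b

/-- `ControlledEvolution g t U` says that a control sequence of total duration `t`, on the system
and an ancilla of dimension `d`, implements the unitary `U θ` when the parameter vector is `θ`.
The controls do not depend on `θ`.  The evolution is generated by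
`H(s) = ∑ j, θ_j g_j ⊗ 1 + H_c(s)` with an arbitrary integrable Hermitian control `H_c`,
and instantaneous unitary gates (the limit of infinitely fast controls) may be interleaved. -/
inductive ControlledEvolution {N m d : ℕ} (g : Fin m → Matrix (Fin N) (Fin N) ℂ) :
    ℝ → ((Fin m → ℝ) → Matrix (Fin N × Fin d) (Fin N × Fin d) ℂ) → Prop
  | drive (τ : ℝ) (hτ : 0 ≤ τ) (Hc : ℝ → Matrix (Fin N × Fin d) (Fin N × Fin d) ℂ)
      (hHerm : ∀ s, (Hc s).IsHermitian)
      (hInt : ∀ a b, IntervalIntegrable (fun s => Hc s a b) volume 0 τ)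
      (U : (Fin m → ℝ) → ℝ → Matrix (Fin N × Fin d) (Fin N × Fin d) ℂ)
      (hU : ∀ θ, IsPropagator
        (fun s => lincomb θ g ⊗ₖ (1 : Matrix (Fin d) (Fin d) ℂ) + Hc s) τ (U θ)) :
      ControlledEvolution g τ (fun θ => U θ τ)
  | gate (V : Matrix (Fin N × Fin d) (Fin N × Fin d) ℂ)
      (hV : V ∈ Matrix.unitaryGroup (Fin N × Fin d) ℂ) :
      ControlledEvolution g 0 (fun _ => V)
  | comp {t₁ t₂ : ℝ} {U₁ U₂ : (Fin m → ℝ) → Matrix (Fin N × Fin d) (Fin N × Fin d) ℂ}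
      (h₁ : ControlledEvolution g t₁ U₁) (h₂ : ControlledEvolution g t₂ U₂) :
      ControlledEvolution g (t₁ + t₂) (fun θ => U₂ θ * U₁ θ)

/-! ### States, measurements, estimators -/

/-- Density matrices. -/
structure DensityMatrix (n : Type*) [Fintype n] where
  mat : Matrix n n ℂ
  posSemidef : mat.PosSemidef
  trace_eq_one : mat.trace = 1

/-- Positive-operator-valued measures on an arbitrary measurable outcome space. -/
structure POVM (X : Type*) [MeasurableSpace X] (n : Type*) [Fintype n] [DecidableEq n] where
  effect : Set X → Matrix n n ℂ
  posSemidef : ∀ s, MeasurableSet s → (effect s).PosSemidef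
  effect_univ : effect univ = 1
  hasSum_effect : ∀ s : ℕ → Set X, (∀ i, MeasurableSet (s i)) → Pairwise (Function.onFun Disjoint s) →
    HasSum (fun i => effect (s i)) (effect (⋃ i, s i))

open scoped MatrixOrder in
theorem trace_mul_re_nonneg {n : Type*} [Fintype n] {A B : Matrix n n ℂ}
    (hA : A.PosSemidef) (hB : B.PosSemidef) : 0 ≤ (A * B).trace.re := by
  classical
  obtain ⟨C, rfl⟩ := CStarAlgebra.nonneg_iff_eq_star_mul_self.mp hA.nonneg
  rw [Matrix.mul_assoc, Matrix.trace_mul_comm, Matrix.star_eq_conjTranspose]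
  exact (Complex.le_def.mp (hB.mul_mul_conjTranspose_same C).trace_nonneg).1

theorem POVM.effect_empty {X : Type*} [MeasurableSpace X] {n : Type*} [Fintype n] [DecidableEq n]
    (E : POVM X n) : E.effect ∅ = 0 := by
  have h := E.hasSum_effect (fun _ => ∅) (fun _ => MeasurableSet.empty)
    (fun _ _ _ => disjoint_bot_left)
  exact tendsto_nhds_unique tendsto_const_nhds h.summable.tendsto_atTop_zero

/-- The outcome distribution `s ↦ Tr (ρ E(s))` (Born rule). -/
def POVM.distribution {X : Type*} [MeasurableSpace X] {n : Type*} [Fintype n] [DecidableEq n]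
    (E : POVM X n) (ρ : Matrix n n ℂ) (hρ : ρ.PosSemidef) : Measure X :=
  Measure.ofMeasurable (fun s _ => ENNReal.ofReal (ρ * E.effect s).trace.re)
    (by simp [E.effect_empty])
    (by
      intro s hs hd
      have h := E.hasSum_effect s hs hd
      have hc : Continuous fun M : Matrix n n ℂ => (ρ * M).trace.re := by fun_prop
      let φ : Matrix n n ℂ →+ ℝ :=
        { toFun := fun M => (ρ * M).trace.re
          map_zero' := by simp
          map_add' := by intro x y; simp [Matrix.mul_add] }
      have h' : HasSum (fun i => (ρ * E.effect (s i)).trace.re)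
          (ρ * E.effect (⋃ i, s i)).trace.re := h.map φ hc
      rw [← h'.tsum_eq]
      exact ENNReal.ofReal_tsum_of_nonneg
        (fun i => trace_mul_re_nonneg hρ (E.posSemidef _ (hs i))) h'.summable)

/-- The outcome distribution of the measurement `E` on the state `U θ ρ (U θ)†`. -/
def outcomeLaw {X : Type*} [MeasurableSpace X] {n : Type*} [Fintype n] [DecidableEq n] {m : ℕ}
    (E : POVM X n) (ρ : DensityMatrix n) (U : (Fin m → ℝ) → Matrix n n ℂ) (θ : Fin m → ℝ) :
    Measure X :=
  E.distribution (U θ * ρ.mat * (U θ)ᴴ) (ρ.posSemidef.mul_mul_conjTranspose_same (U θ))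

/-- The estimator `f` is locally unbiased at `θ` for the linear function `q(θ) = α · θ`:
its expectation is defined near `θ`, and at `θ` the expectation and its first derivatives
agree with those of `q`.
An estimator that is unbiased on a neighbourhood of `θ` is locally unbiased at `θ`. -/
structure IsLocallyUnbiased {X : Type*} [MeasurableSpace X] {m : ℕ}
    (P : (Fin m → ℝ) → Measure X) (f : X → ℝ) (α θ : Fin m → ℝ) : Prop where
  integrable : ∀ᶠ θ' in 𝓝 θ, Integrable f (P θ')
  mean_eq : ∫ x, f x ∂(P θ) = α ⬝ᵥ θ
  hasLineDerivAt : ∀ v : Fin m → ℝ,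
    HasLineDerivAt ℝ (fun θ' => ∫ x, f x ∂(P θ')) (α ⬝ᵥ v) θ v

end

end QMetrology

open QMetrology

/-!
The optimization problems are linked by convex duality, and the estimation bound is a Cramér–Rao
inequality for the generator with the smallest operator seminorm.

*Duality.* A traceless Hermitian `A` satisfies `Tr (A G) ≤ ½ ‖A‖₁ ‖G‖ₛ` (`trace_mul_re_le`), which
gives `1 ≤ ½ ‖A‖₁ ‖β · g‖ₛ` for all feasible `A` and `β`. On traceless Hermitian matrices `‖·‖ₛ`
is a norm, so by linear independence `β ↦ ‖β · g‖ₛ` is continuous and coercive and attains its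
minimum `s` on `α · β = 1`. Equality holds because the vectors `(Tr ((ρ - σ) g_j))_j`, for density
matrices `ρ` and `σ`, form a compact convex set with support function `‖β · g‖ₛ`: a hyperplane
separating `s • α` from it would contradict minimality (`exists_feasible_traceNorm_le`), so
`A = s⁻¹ • (ρ - σ)` is feasible for some `ρ` and `σ`. A feasible point of the linear program in the
basis `K` is the same as a feasible matrix that is diagonal in `K`, with the same norm, and every
Hermitian matrix is diagonal in some basis.

*Estimation.* Let `α · β = 1`. By Duhamel's formula the unitaries implemented at `θ` and
`θ + ε • β` differ, up to a phase that centres the spectrum of `β · g`, by at most `|ε| t ‖β · g‖ₛ / 2` in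
operator norm (`ControlledEvolution.norm_phase_smul_sub_le`, `norm_kronecker_one_sub_le`). The
control is only integrable in time, so the product rule behind the formula is the one for
absolutely continuous functions (`primitive_mul_primitive`).

With `ρ = C Cᴴ` the outcome law is a quadratic function of `A = U C`. For an unbounded estimator
`f` the laws at nearby parameters need not be dominated by the law at `θ`, and `f` need not be
square integrable for them. However, the matrices `B` for which `f` is integrable against the law
of `B Bᴴ` form a linear subspace, on which `∫ f` is a quadratic form, hence bounded by a multiple
of the squared Frobenius norm because the dimension is finite (`exists_abs_integral_le`). The
mixed term of the increment of `∫ f` is bounded by the standard deviation of `f` at `θ` alone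
(`sq_polar_integral_le`). Together they give `1 ≤ t ‖β · g‖ₛ √Var` (`one_le_mul_sqrt_variance`),
and the optimal `β` turns this into the bound with `γ`.
-/

open QMetrology

namespace QMetrology

/-! ### Diagonal matrices, expectation values and the operator seminorm -/

/-- The matrix `∑ k, a_k |k⟩⟨k|`, diagonal with real entries `a` in the orthonormal basis `K`. -/
noncomputable def diagIn {N : ℕ} (K : OrthonormalBasis (Fin N) ℂ (EuclideanSpace ℂ (Fin N)))
    (a : Fin N → ℝ) : Matrix (Fin N) (Fin N) ℂ :=
  ∑ k, (a k : ℂ) • Matrix.vecMulVec (K k).ofLp (star (K k).ofLp)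

section diagIn

variable {N : ℕ} (K : OrthonormalBasis (Fin N) ℂ (EuclideanSpace ℂ (Fin N))) (a b : Fin N → ℝ)

theorem star_dotProduct_basis (i j : Fin N) :
    star (K i).ofLp ⬝ᵥ (K j).ofLp = if i = j then 1 else 0 := by
  rw [dotProduct_comm, ← EuclideanSpace.inner_eq_star_dotProduct]
  exact orthonormal_iff_ite.mp K.orthonormal i j

theorem diagIn_mulVec_basis (j : Fin N) :
    diagIn K a *ᵥ (K j).ofLp = (a j : ℂ) • (K j).ofLp := by
  simp only [diagIn, Matrix.sum_mulVec, Matrix.smul_mulVec, Matrix.vecMulVec_mulVec,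
    star_dotProduct_basis]
  rw [Finset.sum_eq_single j]
  · simp
  · intro k _ hk; simp [hk]
  · simp

theorem matrix_ext_of_basis {A B : Matrix (Fin N) (Fin N) ℂ}
    (h : ∀ k, A *ᵥ (K k).ofLp = B *ᵥ (K k).ofLp) : A = B := by
  apply (Matrix.toEuclideanLin (𝕜 := ℂ)).injective
  refine K.toBasis.ext fun k => ?_
  simpa [Matrix.toLpLin_apply] using h k

theorem diagIn_mul : diagIn K a * diagIn K b = diagIn K (a * b) := by
  refine matrix_ext_of_basis K fun k => ?_
  rw [← Matrix.mulVec_mulVec, diagIn_mulVec_basis, Matrix.mulVec_smul, diagIn_mulVec_basis,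
    diagIn_mulVec_basis, smul_smul]
  simp [mul_comm]

theorem trace_diagIn_mul (B : Matrix (Fin N) (Fin N) ℂ) :
    (diagIn K a * B).trace =
      ∑ k, (a k : ℂ) * inner ℂ (K k) (Matrix.toEuclideanLin B (K k)) := by
  simp only [diagIn, Finset.sum_mul, Matrix.trace_sum, Matrix.smul_mul, Matrix.trace_smul,
    Matrix.trace_mul_comm (Matrix.vecMulVec _ _) B, Matrix.mul_vecMulVec, Matrix.trace_vecMulVec,
    EuclideanSpace.inner_eq_star_dotProduct, Matrix.toLpLin_apply, smul_eq_mul]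

theorem trace_diagIn : (diagIn K a).trace = ((∑ k, a k : ℝ) : ℂ) := by
  rw [← mul_one (diagIn K a), trace_diagIn_mul]
  simp [Matrix.toLpLin_one]

theorem isHermitian_diagIn : (diagIn K a).IsHermitian := by
  simp only [diagIn, Matrix.IsHermitian, Matrix.conjTranspose_sum, Matrix.conjTranspose_smul,
    Matrix.conjTranspose_vecMulVec, star_star]
  simp

theorem posSemidef_diagIn (ha : ∀ k, 0 ≤ a k) : (diagIn K a).PosSemidef := by
  refine Matrix.posSemidef_sum _ fun k _ => ?_
  exact (Matrix.posSemidef_vecMulVec_self_star _).smul (by exact_mod_cast ha k)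

open scoped MatrixOrder in
theorem traceNorm_diagIn : traceNorm (diagIn K a) = ∑ k, |a k| := by
  have h : CFC.sqrt ((diagIn K a)ᴴ * diagIn K a) = diagIn K fun k => |a k| := by
    apply CFC.sqrt_unique
    · rw [(isHermitian_diagIn K a).eq, diagIn_mul, diagIn_mul]
      congr 1
      ext k
      simp
    · exact (posSemidef_diagIn K _ fun k => abs_nonneg _).nonneg
  rw [traceNorm, h, trace_diagIn, Complex.ofReal_re]

theorem diagIn_eigenvalues {A : Matrix (Fin N) (Fin N) ℂ} (hA : A.IsHermitian) :
    diagIn hA.eigenvectorBasis hA.eigenvalues = A := by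
  refine matrix_ext_of_basis hA.eigenvectorBasis fun k => ?_
  rw [diagIn_mulVec_basis, hA.mulVec_eigenvectorBasis]
  ext i
  simp

/-- In an eigenbasis, the trace norm of a Hermitian matrix is the `ℓ¹` norm of its eigenvalues. -/
theorem traceNorm_eq_sum_abs_eigenvalues {A : Matrix (Fin N) (Fin N) ℂ} (hA : A.IsHermitian) :
    traceNorm A = ∑ k, |hA.eigenvalues k| := by
  conv_lhs => rw [← diagIn_eigenvalues hA]
  exact traceNorm_diagIn _ _

/-- Vectors feasible for the linear program in the basis `K` are the diagonal feasible matrices. -/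
theorem diagIn_mem_feasible_iff {m : ℕ} {g : Fin m → Matrix (Fin N) (Fin N) ℂ} {α : Fin m → ℝ} :
    diagIn K a ∈ feasible g α ↔ a ∈ lpFeasible g α K := by
  simp only [feasible, lpFeasible, mem_ofPred_eq, trace_diagIn_mul, trace_diagIn,
    isHermitian_diagIn, true_and, Complex.ofReal_eq_zero]

end diagIn

section opSeminorm

variable {N : ℕ} {G : Matrix (Fin N) (Fin N) ℂ}

/-- The real quadratic form `⟨x|G|x⟩` of a matrix. -/
noncomputable def expval (G : Matrix (Fin N) (Fin N) ℂ) (x : EuclideanSpace ℂ (Fin N)) : ℝ :=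
  (inner ℂ x (Matrix.toEuclideanLin G x)).re

theorem expval_eigenvectorBasis (hG : G.IsHermitian) (k : Fin N) :
    expval G (hG.eigenvectorBasis k) = hG.eigenvalues k := by
  rw [hG.eigenvalues_eq, expval, EuclideanSpace.inner_eq_star_dotProduct, dotProduct_comm]
  simp [Matrix.toLpLin_apply]

/-- The quadratic form is an average of the eigenvalues weighted by squared overlaps. -/
theorem expval_eq_sum (hG : G.IsHermitian) (x : EuclideanSpace ℂ (Fin N)) :
    expval G x = ∑ k, hG.eigenvalues k * ‖inner ℂ (hG.eigenvectorBasis k) x‖ ^ 2 := by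
  have h : ∀ k, inner ℂ (hG.eigenvectorBasis k) (Matrix.toEuclideanLin G x) =
      hG.eigenvalues k * inner ℂ (hG.eigenvectorBasis k) x := by
    intro k
    rw [← (Matrix.isSymmetric_toEuclideanLin_iff.mpr hG) (hG.eigenvectorBasis k) x]
    have : Matrix.toEuclideanLin G (hG.eigenvectorBasis k) =
        (hG.eigenvalues k : ℂ) • hG.eigenvectorBasis k := by
      rw [Matrix.toLpLin_apply, hG.mulVec_eigenvectorBasis]
      ext i; simp
    rw [this, inner_smul_left]
    simp
  rw [expval, ← hG.eigenvectorBasis.sum_inner_mul_inner, Complex.re_sum]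
  refine Finset.sum_congr rfl fun k _ => ?_
  rw [h, mul_left_comm, ← inner_conj_symm x, ← Complex.normSq_eq_conj_mul_self,
    Complex.normSq_eq_norm_sq]
  norm_cast

theorem expval_mem_Icc (hG : G.IsHermitian) {x : EuclideanSpace ℂ (Fin N)} (hx : ‖x‖ = 1) :
    expval G x ∈ Icc (sInf (spectrum ℝ G)) (sSup (spectrum ℝ G)) := by
  have hs := hG.spectrum_real_eq_range_eigenvalues
  have hfin := Matrix.finite_real_spectrum (𝕜 := ℂ) (A := G)
  have hsum : ∑ k, ‖inner ℂ (hG.eigenvectorBasis k) x‖ ^ 2 = 1 := by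
    rw [hG.eigenvectorBasis.sum_sq_norm_inner_right, hx, one_pow]
  rw [expval_eq_sum hG]
  constructor
  · rw [← mul_one (sInf _), ← hsum, Finset.mul_sum]
    exact Finset.sum_le_sum fun k _ => mul_le_mul_of_nonneg_right
      (csInf_le hfin.bddBelow (hG.eigenvalues_mem_spectrum_real k)) (by positivity)
  · rw [← mul_one (sSup _), ← hsum, Finset.mul_sum]
    exact Finset.sum_le_sum fun k _ => mul_le_mul_of_nonneg_right
      (le_csSup hfin.bddAbove (hG.eigenvalues_mem_spectrum_real k)) (by positivity)

theorem expval_sub_le_opSeminorm (hG : G.IsHermitian) {x y : EuclideanSpace ℂ (Fin N)}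
    (hx : ‖x‖ = 1) (hy : ‖y‖ = 1) : expval G x - expval G y ≤ opSeminorm G :=
  sub_le_sub (expval_mem_Icc hG hx).2 (expval_mem_Icc hG hy).1

theorem exists_eigenvalues_eq (hN : 0 < N) (hG : G.IsHermitian) :
    ∃ i j, hG.eigenvalues i = sSup (spectrum ℝ G) ∧ hG.eigenvalues j = sInf (spectrum ℝ G) := by
  have : Nonempty (Fin N) := ⟨⟨0, hN⟩⟩
  have hs := hG.spectrum_real_eq_range_eigenvalues
  have hfin := Matrix.finite_real_spectrum (𝕜 := ℂ) (A := G)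
  have hne : (spectrum ℝ G).Nonempty := hs ▸ range_nonempty _
  have h1 := hne.csSup_mem hfin
  have h2 := hne.csInf_mem hfin
  rw [hs] at h1 h2
  obtain ⟨i, hi⟩ := h1
  obtain ⟨j, hj⟩ := h2
  rw [← hs] at hi hj
  exact ⟨i, j, hi, hj⟩

theorem exists_expval_sub_eq (hN : 0 < N) (hG : G.IsHermitian) :
    ∃ x y : EuclideanSpace ℂ (Fin N), ‖x‖ = 1 ∧ ‖y‖ = 1 ∧
      expval G x - expval G y = opSeminorm G := by
  obtain ⟨i, j, hi, hj⟩ := exists_eigenvalues_eq hN hG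
  exact ⟨_, _, hG.eigenvectorBasis.orthonormal.1 i, hG.eigenvectorBasis.orthonormal.1 j, by
    rw [expval_eigenvectorBasis, expval_eigenvectorBasis, hi, hj, opSeminorm]⟩

theorem opSeminorm_nonneg (hN : 0 < N) (hG : G.IsHermitian) : 0 ≤ opSeminorm G := by
  obtain ⟨x, y, hx, -, -⟩ := exists_expval_sub_eq hN hG
  simpa using expval_sub_le_opSeminorm hG hx hx

/-- A traceless Hermitian matrix with constant spectrum vanishes. -/
theorem eq_zero_of_opSeminorm_eq_zero (hG : G.IsHermitian) (htr : G.trace = 0)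
    (h : opSeminorm G = 0) : G = 0 := by
  have hfin := Matrix.finite_real_spectrum (𝕜 := ℂ) (A := G)
  have hc : ∀ k, hG.eigenvalues k = sSup (spectrum ℝ G) := fun k =>
    le_antisymm (le_csSup hfin.bddAbove (hG.eigenvalues_mem_spectrum_real k))
      ((sub_eq_zero.mp h).trans_le (csInf_le hfin.bddBelow (hG.eigenvalues_mem_spectrum_real k)))
  have hsum : ∑ k, hG.eigenvalues k = 0 := by
    have := hG.trace_eq_sum_eigenvalues
    rw [htr] at this
    rw [← Complex.ofReal_eq_zero, Complex.ofReal_sum]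
    exact this.symm
  have h0 : hG.eigenvalues = 0 := by
    ext k
    have hk : ∑ j, hG.eigenvalues j = N * hG.eigenvalues k := by
      rw [Finset.sum_congr rfl fun j _ => (hc j).trans (hc k).symm]; simp
    have hN : (N : ℝ) ≠ 0 := by
      have := k.pos
      positivity
    simpa [hN] using hk.symm.trans hsum
  exact hG.eigenvalues_eq_zero_iff.mp h0

/-- Hölder duality between the trace norm on traceless matrices and the operator seminorm. -/
theorem trace_mul_re_le {A : Matrix (Fin N) (Fin N) ℂ} (hA : A.IsHermitian) (hA0 : A.trace = 0)
    (hG : G.IsHermitian) : (A * G).trace.re ≤ traceNorm A / 2 * opSeminorm G := by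
  have hsum : ∑ k, hA.eigenvalues k = 0 := by
    have := hA.trace_eq_sum_eigenvalues
    rw [hA0] at this
    rw [← Complex.ofReal_eq_zero, Complex.ofReal_sum]
    exact this.symm
  have h1 : (A * G).trace.re = ∑ k, hA.eigenvalues k * expval G (hA.eigenvectorBasis k) := by
    conv_lhs => rw [← diagIn_eigenvalues hA, trace_diagIn_mul, Complex.re_sum]
    simp [expval]
  -- recentre the expectation values at the middle of the spectrum
  set c : ℝ := (sSup (spectrum ℝ G) + sInf (spectrum ℝ G)) / 2 with hc
  have h2 : (A * G).trace.re =
      ∑ k, hA.eigenvalues k * (expval G (hA.eigenvectorBasis k) - c) := by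
    simp only [h1, mul_sub, Finset.sum_sub_distrib, ← Finset.sum_mul, hsum, zero_mul, sub_zero]
  rw [h2, traceNorm_eq_sum_abs_eigenvalues hA, div_mul_eq_mul_div, mul_div_assoc, Finset.sum_mul]
  refine Finset.sum_le_sum fun k _ => (le_abs_self _).trans ?_
  rw [abs_mul]
  refine mul_le_mul_of_nonneg_left ?_ (abs_nonneg _)
  have := expval_mem_Icc hG (hA.eigenvectorBasis.orthonormal.1 k)
  rw [abs_le, opSeminorm]
  constructor <;> linarith [this.1, this.2]

end opSeminorm

/-! ### Duality between trace norm and operator seminorm -/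

section duality

variable {N m : ℕ} {g : Fin m → Matrix (Fin N) (Fin N) ℂ} {α : Fin m → ℝ}

theorem isHermitian_lincomb (hg : ∀ j, (g j).IsHermitian) (β : Fin m → ℝ) :
    (lincomb β g).IsHermitian := by
  simp only [lincomb, Matrix.IsHermitian, Matrix.conjTranspose_sum, Matrix.conjTranspose_smul,
    (hg _).eq, star_trivial]

theorem trace_lincomb (hTr : ∀ j, (g j).trace = 0) (β : Fin m → ℝ) : (lincomb β g).trace = 0 := by
  simp [lincomb, Matrix.trace_sum, Matrix.trace_smul, hTr]

theorem trace_mul_lincomb (A : Matrix (Fin N) (Fin N) ℂ) (β : Fin m → ℝ) :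
    (A * lincomb β g).trace = ∑ j, β j • (A * g j).trace := by
  simp [lincomb, Finset.mul_sum, Matrix.trace_sum, Matrix.trace_smul]

theorem expval_lincomb (β : Fin m → ℝ) (x : EuclideanSpace ℂ (Fin N)) :
    expval (lincomb β g) x = ∑ j, β j * expval (g j) x := by
  simp only [expval, EuclideanSpace.inner_eq_star_dotProduct, Matrix.toLpLin_apply, lincomb,
    Matrix.sum_mulVec, Matrix.smul_mulVec, sum_dotProduct, smul_dotProduct, Complex.re_sum,
    Complex.smul_re, smul_eq_mul]

theorem lincomb_eq_zero (hLin : LinearIndependent ℝ g) {β : Fin m → ℝ} (h : lincomb β g = 0) :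
    β = 0 :=
  funext (Fintype.linearIndependent_iff.mp hLin β h)

/-- Weak duality between the trace-norm problem and the seminorm problem. -/
theorem one_le_traceNorm_mul_opSeminorm (hg : ∀ j, (g j).IsHermitian)
    {A : Matrix (Fin N) (Fin N) ℂ} (hA : A ∈ feasible g α) {β : Fin m → ℝ} (hβ : α ⬝ᵥ β = 1) :
    1 ≤ traceNorm A / 2 * opSeminorm (lincomb β g) := by
  refine le_trans ?_ (trace_mul_re_le hA.1 hA.2.2 (isHermitian_lincomb hg β))
  rw [trace_mul_lincomb, Complex.re_sum, ← hβ, dotProduct]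
  refine Finset.sum_le_sum fun j _ => ?_
  rw [hA.2.1 j]
  simp [mul_comm]

theorem convexOn_opSeminorm_lincomb (hN : 0 < N) (hg : ∀ j, (g j).IsHermitian) :
    ConvexOn ℝ univ fun β : Fin m → ℝ => opSeminorm (lincomb β g) := by
  refine ⟨convex_univ, fun β _ β' _ a b ha hb _ => ?_⟩
  obtain ⟨x, y, hx, hy, h⟩ := exists_expval_sub_eq hN (isHermitian_lincomb hg (a • β + b • β'))
  have h1 := mul_le_mul_of_nonneg_left
    (expval_sub_le_opSeminorm (isHermitian_lincomb hg β) hx hy) ha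
  have h2 := mul_le_mul_of_nonneg_left
    (expval_sub_le_opSeminorm (isHermitian_lincomb hg β') hx hy) hb
  have h3 : ∀ z, expval (lincomb (a • β + b • β') g) z =
      a * expval (lincomb β g) z + b * expval (lincomb β' g) z := by
    intro z
    simp only [expval_lincomb, Finset.mul_sum, ← Finset.sum_add_distrib]
    refine Finset.sum_congr rfl fun j _ => ?_
    simp only [Pi.add_apply, Pi.smul_apply, smul_eq_mul]
    ring
  simp only [smul_eq_mul]
  rw [← h, h3, h3]
  linarith

theorem continuous_opSeminorm_lincomb (hN : 0 < N) (hg : ∀ j, (g j).IsHermitian) :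
    Continuous fun β : Fin m → ℝ => opSeminorm (lincomb β g) :=
  continuousOn_univ.mp ((convexOn_opSeminorm_lincomb hN hg).continuousOn isOpen_univ)

theorem smul_opSeminorm_lincomb_le (hN : 0 < N) (hg : ∀ j, (g j).IsHermitian) (r : ℝ)
    (β : Fin m → ℝ) : r * opSeminorm (lincomb β g) ≤ opSeminorm (lincomb (r • β) g) := by
  obtain ⟨x, y, hx, hy, h⟩ := exists_expval_sub_eq hN (isHermitian_lincomb hg β)
  have h3 : ∀ z, expval (lincomb (r • β) g) z = r * expval (lincomb β g) z := by
    intro z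
    simp [expval_lincomb, Finset.mul_sum, mul_assoc]
  rw [← h, mul_sub, ← h3, ← h3]
  exact expval_sub_le_opSeminorm (isHermitian_lincomb hg _) hx hy

theorem opSeminorm_lincomb_pos (hN : 0 < N) (hg : ∀ j, (g j).IsHermitian)
    (hTr : ∀ j, (g j).trace = 0) (hLin : LinearIndependent ℝ g) {β : Fin m → ℝ} (hβ : β ≠ 0) :
    0 < opSeminorm (lincomb β g) :=
  (opSeminorm_nonneg hN (isHermitian_lincomb hg β)).lt_of_ne' fun h =>
    hβ (lincomb_eq_zero hLin
      (eq_zero_of_opSeminorm_eq_zero (isHermitian_lincomb hg β) (trace_lincomb hTr β) h))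

theorem exists_mul_norm_le_opSeminorm (hN : 0 < N) (hm : 0 < m) (hg : ∀ j, (g j).IsHermitian)
    (hTr : ∀ j, (g j).trace = 0) (hLin : LinearIndependent ℝ g) :
    ∃ c > 0, ∀ β : Fin m → ℝ, c * ‖β‖ ≤ opSeminorm (lincomb β g) := by
  have : Nonempty (Fin m) := ⟨⟨0, hm⟩⟩
  obtain ⟨u, hu, hmin⟩ := (isCompact_sphere (0 : Fin m → ℝ) 1).exists_isMinOn
    (NormedSpace.sphere_nonempty.mpr zero_le_one) (continuous_opSeminorm_lincomb hN hg).continuousOn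
  refine ⟨_, opSeminorm_lincomb_pos hN hg hTr hLin
    (ne_zero_of_mem_unit_sphere (⟨u, hu⟩ : Metric.sphere (0 : Fin m → ℝ) 1)), fun β => ?_⟩
  rcases eq_or_ne β 0 with rfl | hβ
  · simpa using opSeminorm_nonneg hN (isHermitian_lincomb hg 0)
  · have h := smul_opSeminorm_lincomb_le hN hg ‖β‖ (‖β‖⁻¹ • β)
    rw [smul_inv_smul₀ (norm_ne_zero_iff.mpr hβ)] at h
    refine le_trans ?_ h
    rw [mul_comm]
    refine mul_le_mul_of_nonneg_left (hmin ?_) (norm_nonneg _)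
    simp [norm_smul, hβ]

theorem exists_isMinOn_opSeminorm (hN : 0 < N) (hg : ∀ j, (g j).IsHermitian)
    (hTr : ∀ j, (g j).trace = 0) (hLin : LinearIndependent ℝ g) (hα : α ≠ 0) :
    ∃ β, α ⬝ᵥ β = 1 ∧
      ∀ β', α ⬝ᵥ β' = 1 → opSeminorm (lincomb β g) ≤ opSeminorm (lincomb β' g) := by
  have hm : 0 < m := by
    rcases Nat.eq_zero_or_pos m with rfl | h
    · exact absurd (Subsingleton.elim α 0) hα
    · exact h
  obtain ⟨c, hc, hcoer⟩ := exists_mul_norm_le_opSeminorm hN hm hg hTr hLin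
  have hαα : α ⬝ᵥ α ≠ 0 := fun h => hα (dotProduct_self_eq_zero.mp h)
  have hclosed : IsClosed {β : Fin m → ℝ | α ⬝ᵥ β = 1} :=
    isClosed_eq (f := fun β => α ⬝ᵥ β) (by unfold dotProduct; fun_prop) continuous_const
  have h0 : (α ⬝ᵥ α)⁻¹ • α ∈ {β : Fin m → ℝ | α ⬝ᵥ β = 1} := by
    simp [dotProduct_smul, hαα]
  have hev : ∀ x₀ : ℝ, ∀ᶠ β : Fin m → ℝ in cocompact (Fin m → ℝ),
      x₀ ≤ opSeminorm (lincomb β g) := by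
    intro x₀
    have := (tendsto_norm_cocompact_atTop (E := Fin m → ℝ)).const_mul_atTop hc
    filter_upwards [this.eventually_ge_atTop x₀] with β hβ using hβ.trans (hcoer β)
  obtain ⟨β, hβ, hmin⟩ := (continuous_opSeminorm_lincomb hN hg).continuousOn.exists_isMinOn'
    hclosed h0 ((hev _).filter_mono inf_le_left)
  exact ⟨β, hβ, fun β' hβ' => hmin hβ'⟩

end duality

section separation

variable {N m : ℕ}

theorem convex_density : Convex ℝ {ρ : Matrix (Fin N) (Fin N) ℂ | ρ.PosSemidef ∧ ρ.trace = 1} := by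
  rintro ρ ⟨hρ, hρ1⟩ σ ⟨hσ, hσ1⟩ a b ha hb hab
  refine ⟨(hρ.smul ha).add (hσ.smul hb), ?_⟩
  rw [Matrix.trace_add, Matrix.trace_smul, Matrix.trace_smul, hρ1, hσ1]
  simp only [Complex.real_smul, mul_one]
  exact_mod_cast hab

theorem trace_mul_conjTranspose_self {n : Type*} [Fintype n] (B : Matrix n n ℂ) :
    (B * Bᴴ).trace = ((∑ i, ∑ j, ‖B i j‖ ^ 2 : ℝ) : ℂ) := by
  simp [Matrix.trace, Matrix.mul_apply, Complex.mul_conj, Complex.normSq_eq_norm_sq]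

open scoped MatrixOrder in
/-- Density matrices are the `B Bᴴ` with `B` on the Frobenius unit sphere. -/
theorem isCompact_density :
    IsCompact {ρ : Matrix (Fin N) (Fin N) ℂ | ρ.PosSemidef ∧ ρ.trace = 1} := by
  have hB : IsCompact {B : Matrix (Fin N) (Fin N) ℂ | (B * Bᴴ).trace = 1} := by
    have hK : IsCompact (X := Matrix (Fin N) (Fin N) ℂ) (univ.pi fun _ : Fin N =>
        univ.pi fun _ : Fin N => Metric.closedBall (0 : ℂ) 1) :=
      isCompact_univ_pi fun _ => isCompact_univ_pi fun _ => isCompact_closedBall _ _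
    refine hK.of_isClosed_subset (isClosed_eq (by fun_prop) continuous_const) ?_
    intro (B : Matrix (Fin N) (Fin N) ℂ) (hB : (B * Bᴴ).trace = 1) i _ j _
    have h : ∑ i, ∑ j, ‖B i j‖ ^ 2 = 1 := by
      rw [trace_mul_conjTranspose_self] at hB
      exact_mod_cast hB
    have h2 : ‖B i j‖ ^ 2 ≤ 1 := by
      rw [← h]
      exact (Finset.single_le_sum (f := fun j => ‖B i j‖ ^ 2) (fun _ _ => by positivity)
        (Finset.mem_univ j)).trans (Finset.single_le_sum (f := fun i => ∑ j, ‖B i j‖ ^ 2)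
          (fun _ _ => by positivity) (Finset.mem_univ i))
    simpa [mem_closedBall_zero_iff] using (sq_le_one_iff₀ (norm_nonneg _)).mp h2
  convert hB.image (f := fun B => B * Bᴴ) (by fun_prop) using 1
  ext ρ
  constructor
  · rintro ⟨hρ, h1⟩
    obtain ⟨C, rfl⟩ := CStarAlgebra.nonneg_iff_eq_mul_star_self.mp hρ.nonneg
    exact ⟨C, h1, rfl⟩
  · rintro ⟨B, hB, rfl⟩
    exact ⟨Matrix.posSemidef_self_mul_conjTranspose B, hB⟩

/-- The pure state of a unit vector reproduces its expectation values. -/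
theorem exists_density_expval {x : EuclideanSpace ℂ (Fin N)} (hx : ‖x‖ = 1) :
    ∃ ρ : Matrix (Fin N) (Fin N) ℂ, ρ.PosSemidef ∧ ρ.trace = 1 ∧
      ∀ G, (ρ * G).trace.re = expval G x := by
  refine ⟨Matrix.vecMulVec x.ofLp (star x.ofLp), Matrix.posSemidef_vecMulVec_self_star _, ?_, ?_⟩
  · rw [Matrix.trace_vecMulVec, ← EuclideanSpace.inner_eq_star_dotProduct,
      inner_self_eq_norm_sq_to_K, hx]
    simp
  · intro G
    rw [Matrix.trace_mul_comm, Matrix.mul_vecMulVec, Matrix.trace_vecMulVec, expval,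
      EuclideanSpace.inner_eq_star_dotProduct, Matrix.toLpLin_apply]

theorem expval_nonneg {ρ : Matrix (Fin N) (Fin N) ℂ} (hρ : ρ.PosSemidef)
    (x : EuclideanSpace ℂ (Fin N)) : 0 ≤ expval ρ x := by
  rw [expval, EuclideanSpace.inner_eq_star_dotProduct, Matrix.toLpLin_apply, dotProduct_comm]
  exact hρ.re_dotProduct_nonneg x.ofLp

theorem traceNorm_smul_sub_le {ρ σ : Matrix (Fin N) (Fin N) ℂ} (hρ : ρ.PosSemidef)
    (hρ1 : ρ.trace = 1) (hσ : σ.PosSemidef) (hσ1 : σ.trace = 1) {c : ℝ} (hc : 0 ≤ c) :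
    traceNorm (c • (ρ - σ)) ≤ 2 * c := by
  have hA : (c • (ρ - σ)).IsHermitian := by
    simp [Matrix.IsHermitian, hρ.isHermitian.eq, hσ.isHermitian.eq]
  have htr : ∀ τ : Matrix (Fin N) (Fin N) ℂ, τ.trace = 1 →
      ∑ k, expval τ (hA.eigenvectorBasis k) = 1 := by
    intro τ hτ
    have := trace_diagIn_mul hA.eigenvectorBasis (fun _ => 1) τ
    have h1 : diagIn hA.eigenvectorBasis (fun _ => 1) = 1 :=
      matrix_ext_of_basis hA.eigenvectorBasis fun k => by simp [diagIn_mulVec_basis]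
    rw [h1, one_mul, hτ] at this
    simpa [expval] using (congrArg Complex.re this).symm
  rw [traceNorm_eq_sum_abs_eigenvalues hA]
  calc ∑ k, |hA.eigenvalues k|
      ≤ ∑ k, c * (expval ρ (hA.eigenvectorBasis k) + expval σ (hA.eigenvectorBasis k)) := by
        refine Finset.sum_le_sum fun k _ => ?_
        have h : expval (c • (ρ - σ)) (hA.eigenvectorBasis k) =
            c * (expval ρ (hA.eigenvectorBasis k) - expval σ (hA.eigenvectorBasis k)) := by
          simp [expval, EuclideanSpace.inner_eq_star_dotProduct, Matrix.toLpLin_apply,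
            Matrix.smul_mulVec, Matrix.sub_mulVec]
        rw [← expval_eigenvectorBasis, h, abs_mul, abs_of_nonneg hc]
        refine mul_le_mul_of_nonneg_left ?_ hc
        have h1 := expval_nonneg hρ (hA.eigenvectorBasis k)
        have h2 := expval_nonneg hσ (hA.eigenvectorBasis k)
        rw [abs_le]
        constructor <;> linarith
    _ = 2 * c := by
        rw [← Finset.mul_sum, Finset.sum_add_distrib, htr ρ hρ1, htr σ hσ1]
        ring

variable {g : Fin m → Matrix (Fin N) (Fin N) ℂ} {α : Fin m → ℝ}

/-- Strong duality. The vectors `(Tr ((ρ - σ) g_j))_j` for density matrices `ρ`, `σ` form a compact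
convex set whose support function is `β ↦ ‖β · g‖ₛ`. A hyperplane separating `s • α` from it would
produce some `β` with `α · β = 1` and `‖β · g‖ₛ < s`. -/
theorem exists_feasible_traceNorm_le (hN : 0 < N) (hg : ∀ j, (g j).IsHermitian) {s : ℝ}
    (hs : 0 < s) (hmin : ∀ β, α ⬝ᵥ β = 1 → s ≤ opSeminorm (lincomb β g)) :
    ∃ A ∈ feasible g α, traceNorm A / 2 ≤ s⁻¹ := by
  let D := {ρ : Matrix (Fin N) (Fin N) ℂ | ρ.PosSemidef ∧ ρ.trace = 1}
  let φ : Matrix (Fin N) (Fin N) ℂ × Matrix (Fin N) (Fin N) ℂ →ₗ[ℝ] (Fin m → ℝ) :=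
    { toFun := fun p j => ((p.1 - p.2) * g j).trace.re
      map_add' := by
        intro p q
        ext j
        simp only [Prod.fst_add, Prod.snd_add, add_sub_add_comm, Matrix.add_mul, Matrix.trace_add,
          Complex.add_re, Pi.add_apply]
      map_smul' := by
        intro c p
        ext j
        simp [← smul_sub, Matrix.trace_smul] }
  have hφ : Continuous φ := by
    change Continuous fun (p : Matrix (Fin N) (Fin N) ℂ × Matrix (Fin N) (Fin N) ℂ) j =>
      ((p.1 - p.2) * g j).trace.re
    fun_prop
  have hS : IsClosed (φ '' (D ×ˢ D)) :=
    ((isCompact_density.prod isCompact_density).image hφ).isClosed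
  have hconv : Convex ℝ (φ '' (D ×ˢ D)) := (convex_density.prod convex_density).linear_image φ
  by_cases hmem : s • α ∈ φ '' (D ×ˢ D)
  · obtain ⟨⟨ρ, σ⟩, ⟨⟨hρ, hρ1⟩, hσ, hσ1⟩, hp⟩ := hmem
    have hH : (s⁻¹ • (ρ - σ)).IsHermitian := by
      simp [Matrix.IsHermitian, hρ.isHermitian.eq, hσ.isHermitian.eq]
    refine ⟨s⁻¹ • (ρ - σ), ⟨hH, fun j => ?_, ?_⟩, ?_⟩
    · have hre : ((ρ - σ) * g j).trace.re = s * α j := congrFun hp j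
      have him : (((ρ - σ) * g j).trace).im = 0 := by
        rw [← Complex.conj_eq_iff_im, ← Complex.star_def, ← Matrix.trace_conjTranspose,
          Matrix.conjTranspose_mul, (hg j).eq, Matrix.conjTranspose_sub, hρ.isHermitian.eq,
          hσ.isHermitian.eq, Matrix.trace_mul_comm]
      have h := Complex.ext (z := ((ρ - σ) * g j).trace) (w := ((s * α j : ℝ) : ℂ))
        (by simpa using hre) (by simpa using him)
      rw [Matrix.smul_mul, Matrix.trace_smul, h, Complex.real_smul, ← Complex.ofReal_mul,
        inv_mul_cancel_left₀ hs.ne']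
    · simp [Matrix.trace_smul, hρ1, hσ1]
    · linarith [traceNorm_smul_sub_le hρ hρ1 hσ hσ1 (inv_nonneg.mpr hs.le)]
  · exfalso
    obtain ⟨f, u, hlt, hu⟩ := geometric_hahn_banach_closed_point hconv hS hmem
    let β : Fin m → ℝ := fun j => f (Pi.single j 1)
    have hf : ∀ v, f v = ∑ j, v j * β j := by
      intro v
      conv_lhs => rw [← Finset.univ_sum_single v]
      rw [map_sum]
      refine Finset.sum_congr rfl fun j _ => ?_
      rw [← mul_one (v j), ← smul_eq_mul, Pi.single_smul, map_smul, smul_eq_mul]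
      simp [β]
    obtain ⟨x, y, hx, hy, hxy⟩ := exists_expval_sub_eq hN (isHermitian_lincomb hg β)
    obtain ⟨ρ, hρ, hρ1, hρG⟩ := exists_density_expval hx
    obtain ⟨σ, hσ, hσ1, hσG⟩ := exists_density_expval hy
    have h1 : opSeminorm (lincomb β g) < u := by
      have := hlt _ ⟨(ρ, σ), ⟨⟨hρ, hρ1⟩, hσ, hσ1⟩, rfl⟩
      convert this using 1
      rw [hf, ← hxy, expval_lincomb, expval_lincomb, ← Finset.sum_sub_distrib]
      refine Finset.sum_congr rfl fun j _ => ?_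
      change _ = ((ρ - σ) * g j).trace.re * β j
      rw [Matrix.sub_mul, Matrix.trace_sub, Complex.sub_re, hρG, hσG]
      ring
    have h2 : opSeminorm (lincomb β g) < s * (α ⬝ᵥ β) := by
      refine h1.trans (hu.trans_eq ?_)
      rw [hf, dotProduct, Finset.mul_sum]
      simp [mul_assoc]
    have h3 : 0 < α ⬝ᵥ β := by
      have := (opSeminorm_nonneg hN (isHermitian_lincomb hg β)).trans_lt h2
      exact (mul_pos_iff_of_pos_left hs).mp this
    have h4 := hmin ((α ⬝ᵥ β)⁻¹ • β) (by rw [dotProduct_smul, smul_eq_mul, inv_mul_cancel₀ h3.ne'])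
    have h5 := smul_opSeminorm_lincomb_le hN hg (α ⬝ᵥ β) ((α ⬝ᵥ β)⁻¹ • β)
    rw [smul_inv_smul₀ h3.ne'] at h5
    nlinarith

end separation

/-! ### The linear programs -/

section linearPrograms

variable {N m : ℕ} {g : Fin m → Matrix (Fin N) (Fin N) ℂ} {α : Fin m → ℝ}

theorem isClosed_lpFeasible (K : OrthonormalBasis (Fin N) ℂ (EuclideanSpace ℂ (Fin N))) :
    IsClosed (lpFeasible g α K) := by
  rw [lpFeasible, ofPred_and, ofPred_forall]
  refine (isClosed_iInter fun j => isClosed_eq ?_ continuous_const).inter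
    (isClosed_eq ?_ continuous_const) <;> fun_prop

theorem exists_isLeast_lpValues {t : ℝ} (ht : 0 < t)
    (K : OrthonormalBasis (Fin N) ℂ (EuclideanSpace ℂ (Fin N)))
    (hK : (lpFeasible g α K).Nonempty) : ∃ v, IsLeast (lpValues g α t K) v := by
  obtain ⟨a₀, h₀⟩ := hK
  have hcont : Continuous fun a : Fin N → ℝ => ∑ k, |a k| := by fun_prop
  have hnorm : ∀ a : Fin N → ℝ, ‖a‖ ≤ ∑ k, |a k| := fun a =>
    (pi_norm_le_iff_of_nonneg (Finset.sum_nonneg fun _ _ => abs_nonneg _)).mpr fun k =>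
      Finset.single_le_sum (f := fun k => |a k|) (fun _ _ => abs_nonneg _) (Finset.mem_univ k)
  obtain ⟨a, ha, hmin⟩ := hcont.continuousOn.exists_isMinOn' (isClosed_lpFeasible K) h₀ (by
    filter_upwards [(tendsto_norm_cocompact_atTop.eventually_ge_atTop
      (∑ k, |a₀ k|)).filter_mono inf_le_left] with a ha using ha.trans (hnorm a))
  refine ⟨_, ⟨a, ha, rfl⟩, ?_⟩
  rintro _ ⟨b, hb, rfl⟩
  have hab : ∑ k, |a k| ≤ ∑ k, |b k| := hmin hb
  have hpos : 0 ≤ ∑ k, |a k| := Finset.sum_nonneg fun _ _ => abs_nonneg _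
  dsimp only
  gcongr

theorem isLeast_lpOptima {t : ℝ} (hγ0 : 0 ≤ gamma g α)
    (hγ : IsLeast ((fun A => traceNorm A / 2) '' feasible g α) (gamma g α)) :
    IsLeast {v | ∃ K, IsLeast (lpValues g α t K) v} (gamma g α ^ 2 / t ^ 2) := by
  have hlow : ∀ K, gamma g α ^ 2 / t ^ 2 ∈ lowerBounds (lpValues g α t K) := by
    rintro K _ ⟨a, ha, rfl⟩
    have h := hγ.2 ⟨_, (diagIn_mem_feasible_iff K a).mpr ha, rfl⟩
    dsimp only at h ⊢
    rw [traceNorm_diagIn] at h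
    rw [← div_div, show (∑ k, |a k|) ^ 2 / 4 = ((∑ k, |a k|) / 2) ^ 2 by ring]
    gcongr
  constructor
  · obtain ⟨A, hA, hAγ⟩ := hγ.1
    refine ⟨hA.1.eigenvectorBasis, ⟨hA.1.eigenvalues, ?_, ?_⟩, hlow _⟩
    · rw [← diagIn_mem_feasible_iff, diagIn_eigenvalues]
      exact hA
    · dsimp only at hAγ ⊢
      rw [← hAγ, ← traceNorm_eq_sum_abs_eigenvalues hA.1]
      ring
  · rintro v ⟨K, hv⟩
    exact hlow K hv.1

/-- Strong duality with attainment on both sides. -/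
theorem gamma_duality (hN : 0 < N) (hg : ∀ j, (g j).IsHermitian) (hTr : ∀ j, (g j).trace = 0)
    (hLin : LinearIndependent ℝ g) (hα : α ≠ 0) :
    0 < gamma g α ∧ IsLeast ((fun A => traceNorm A / 2) '' feasible g α) (gamma g α) ∧
      IsLeast ((fun β => opSeminorm (lincomb β g)) '' {β : Fin m → ℝ | α ⬝ᵥ β = 1})
        (gamma g α)⁻¹ := by
  obtain ⟨β, hβ, hmin⟩ := exists_isMinOn_opSeminorm hN hg hTr hLin hα
  have hs : 0 < opSeminorm (lincomb β g) := by
    refine opSeminorm_lincomb_pos hN hg hTr hLin ?_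
    rintro rfl
    simp at hβ
  obtain ⟨A, hA, hAs⟩ := exists_feasible_traceNorm_le hN hg hs hmin
  have hlow : ∀ B ∈ feasible g α, (opSeminorm (lincomb β g))⁻¹ ≤ traceNorm B / 2 := fun B hB =>
    (inv_le_iff_one_le_mul₀ hs).mpr (one_le_traceNorm_mul_opSeminorm hg hB hβ)
  have hleast : IsLeast ((fun A => traceNorm A / 2) '' feasible g α)
      (opSeminorm (lincomb β g))⁻¹ := by
    refine ⟨⟨A, hA, hAs.antisymm (hlow A hA)⟩, ?_⟩
    rintro _ ⟨B, hB, rfl⟩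
    exact hlow B hB
  have hγ : gamma g α = (opSeminorm (lincomb β g))⁻¹ := hleast.csInf_eq
  rw [hγ, inv_inv]
  refine ⟨inv_pos.mpr hs, hleast, ⟨β, hβ, rfl⟩, ?_⟩
  rintro _ ⟨β', hβ', rfl⟩
  exact hmin β' hβ'

end linearPrograms

/-! ### Absolutely continuous functions and propagators -/

section productRule

theorem absolutelyContinuousOnInterval_primitive {E : Type*} [NormedAddCommGroup E]
    [NormedSpace ℝ E] {f : ℝ → E} {τ : ℝ} (hf : IntervalIntegrable f volume 0 τ) :
    AbsolutelyContinuousOnInterval (fun s => ∫ r in (0 : ℝ)..s, f r) 0 τ := by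
  have h := hf.norm.absolutelyContinuousOnInterval_intervalIntegral (c := 0) (by simp)
  refine squeeze_zero' (Eventually.of_forall fun E => Finset.sum_nonneg fun _ _ => dist_nonneg)
    ?_ h
  filter_upwards [mem_inf_of_right (mem_principal_self _)] with E hE
  refine Finset.sum_le_sum fun i hi => ?_
  have hmem := hE.1 i hi
  have hint : ∀ x ∈ uIcc 0 τ, IntervalIntegrable f volume 0 x := fun x hx =>
    hf.mono_set (uIcc_subset_uIcc left_mem_uIcc hx)
  rw [dist_comm, dist_comm (∫ r in (0 : ℝ)..(E.2 i).1, ‖f r‖), dist_eq_norm, dist_eq_norm,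
    intervalIntegral.integral_interval_sub_left (hint _ hmem.2) (hint _ hmem.1),
    intervalIntegral.integral_interval_sub_left (hint _ hmem.2).norm (hint _ hmem.1).norm]
  exact (intervalIntegral.norm_integral_le_abs_integral_norm).trans_eq (Real.norm_eq_abs _).symm

theorem absolutelyContinuousOnInterval_mul {𝔸 : Type*} [NormedRing 𝔸] {f g : ℝ → 𝔸} {a b : ℝ}
    (hf : AbsolutelyContinuousOnInterval f a b) (hg : AbsolutelyContinuousOnInterval g a b) :
    AbsolutelyContinuousOnInterval (fun x => f x * g x) a b := by
  obtain ⟨C, hC⟩ := hf.exists_bound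
  obtain ⟨D, hD⟩ := hg.exists_bound
  refine squeeze_zero' (Eventually.of_forall fun E => Finset.sum_nonneg fun _ _ => dist_nonneg)
    ?_ (by simpa using (Tendsto.const_mul C hg).add (Tendsto.const_mul D hf))
  filter_upwards [mem_inf_of_right (mem_principal_self _)] with E hE
  rw [Finset.mul_sum, Finset.mul_sum, ← Finset.sum_add_distrib]
  refine Finset.sum_le_sum fun i hi => ?_
  have hmem := hE.1 i hi
  simp only [dist_eq_norm]
  have hsplit : f (E.2 i).1 * g (E.2 i).1 - f (E.2 i).2 * g (E.2 i).2 =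
      f (E.2 i).1 * (g (E.2 i).1 - g (E.2 i).2) + (f (E.2 i).1 - f (E.2 i).2) * g (E.2 i).2 := by
    noncomm_ring
  rw [hsplit]
  refine (norm_add_le _ _).trans (add_le_add ?_ ?_)
  · exact (norm_mul_le _ _).trans (mul_le_mul_of_nonneg_right (hC _ hmem.1) (norm_nonneg _))
  · rw [mul_comm D]
    exact (norm_mul_le _ _).trans (mul_le_mul_of_nonneg_left (hD _ hmem.2) (norm_nonneg _))

variable {𝔸 : Type*} [NormedRing 𝔸] [NormedAlgebra ℝ 𝔸] [CompleteSpace 𝔸]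

/-- The product rule for primitives of integrable functions with values in a Banach algebra. -/
theorem primitive_mul_primitive {u v u' v' : ℝ → 𝔸} {a b : 𝔸} {τ : ℝ} (hτ : 0 ≤ τ)
    (hu' : IntervalIntegrable u' volume 0 τ) (hv' : IntervalIntegrable v' volume 0 τ)
    (hu : ∀ s ∈ Icc 0 τ, u s = a + ∫ r in (0 : ℝ)..s, u' r)
    (hv : ∀ s ∈ Icc 0 τ, v s = b + ∫ r in (0 : ℝ)..s, v' r) :
    u τ * v τ = a * b + ∫ r in (0 : ℝ)..τ, (u' r * v r + u r * v' r) := by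
  set p : ℝ → 𝔸 := fun s => a + ∫ r in (0 : ℝ)..s, u' r with hp
  set q : ℝ → 𝔸 := fun s => b + ∫ r in (0 : ℝ)..s, v' r with hq
  have hconst : ∀ c : 𝔸, AbsolutelyContinuousOnInterval (fun _ : ℝ => c) 0 τ := fun c =>
    (LipschitzWith.const c).lipschitzOnWith.absolutelyContinuousOnInterval
  have hpAC : AbsolutelyContinuousOnInterval p 0 τ :=
    (hconst a).fun_add (absolutelyContinuousOnInterval_primitive hu')
  have hqAC : AbsolutelyContinuousOnInterval q 0 τ :=
    (hconst b).fun_add (absolutelyContinuousOnInterval_primitive hv')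
  have hint : IntervalIntegrable (fun r => u' r * q r + p r * v' r) volume 0 τ :=
    (hu'.mul_continuousOn hqAC.continuousOn).add (hv'.continuousOn_mul hpAC.continuousOn)
  have hAC : AbsolutelyContinuousOnInterval
      (fun s => p s * q s - ∫ r in (0 : ℝ)..s, (u' r * q r + p r * v' r)) 0 τ :=
    (absolutelyContinuousOnInterval_mul hpAC hqAC).fun_sub
      (absolutelyContinuousOnInterval_primitive hint)
  obtain ⟨C, hC⟩ := hAC.const_of_ae_hasDerivAt_zero (by
    filter_upwards [hu'.ae_hasDerivAt_integral, hv'.ae_hasDerivAt_integral,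
      hint.ae_hasDerivAt_integral] with x h1 h2 h3 hx
    have h1' := ((h1 hx 0 left_mem_uIcc).const_add a).mul ((h2 hx 0 left_mem_uIcc).const_add b)
    have h4 := h1'.sub (h3 hx 0 left_mem_uIcc)
    rwa [sub_self] at h4)
  have h0 := hC 0 left_mem_uIcc
  have h1 := hC τ right_mem_uIcc
  simp only [hp, hq, intervalIntegral.integral_same, add_zero, sub_zero] at h0
  rw [← h0, sub_eq_iff_eq_add] at h1
  rw [hu τ ⟨hτ, le_rfl⟩, hv τ ⟨hτ, le_rfl⟩]
  refine h1.trans ?_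
  congr 1
  refine intervalIntegral.integral_congr fun r hr => ?_
  rw [uIcc_of_le hτ] at hr
  simp only [hu r hr, hv r hr, hp, hq]

end productRule

section propagators

open scoped Matrix.Norms.L2Operator

variable {n : Type*} [Fintype n] [DecidableEq n]

theorem intervalIntegrable_matrix {F : ℝ → Matrix n n ℂ} {τ : ℝ}
    (h : ∀ a b, IntervalIntegrable (fun s => F s a b) volume 0 τ) :
    IntervalIntegrable F volume 0 τ := by
  have hF : F = ∑ a, ∑ b, fun s => Matrix.single a b (F s a b) := by
    ext1 s
    rw [Finset.sum_apply]
    simp only [Finset.sum_apply]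
    exact Matrix.matrix_eq_sum_single _
  rw [hF]
  refine IntervalIntegrable.sum _ fun a _ => IntervalIntegrable.sum _ fun b _ => ?_
  let L : ℂ →L[ℝ] Matrix n n ℂ :=
    LinearMap.toContinuousLinearMap (Matrix.singleLinearMap ℝ a b)
  exact ⟨L.integrable_comp (h a b).1, L.integrable_comp (h a b).2⟩

theorem intervalIntegral_matrix_apply {F : ℝ → Matrix n n ℂ} {x y : ℝ}
    (h : IntervalIntegrable F volume x y) (a b : n) :
    (∫ s in x..y, F s) a b = ∫ s in x..y, F s a b := by
  let L : Matrix n n ℂ →L[ℝ] ℂ := LinearMap.toContinuousLinearMap (Matrix.entryLinearMap ℝ ℂ a b)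
  exact (L.intervalIntegral_comp_comm h).symm

theorem intervalIntegral_star {F : ℝ → Matrix n n ℂ} {x y : ℝ}
    (h : IntervalIntegrable F volume x y) :
    ∫ s in x..y, star (F s) = star (∫ s in x..y, F s) :=
  (starL' ℝ : Matrix n n ℂ ≃L[ℝ] Matrix n n ℂ).toContinuousLinearMap.intervalIntegral_comp_comm h

/-- The entrywise integral equation, written as one equation between matrices. -/
theorem IsPropagator.eq_matrix_integral {H U : ℝ → Matrix n n ℂ} {τ : ℝ}
    (hH : IntervalIntegrable H volume 0 τ) (hτ : 0 ≤ τ) (hU : IsPropagator H τ U) :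
    ∀ s ∈ Icc 0 τ, U s = 1 + ∫ r in (0 : ℝ)..s, (-Complex.I) • (H r * U r) := by
  intro s hs
  have hHU : IntervalIntegrable (fun r => H r * U r) volume 0 τ :=
    hH.mul_continuousOn (by rw [uIcc_of_le hτ]; exact hU.continuousOn)
  have hs' : IntervalIntegrable (fun r => H r * U r) volume 0 s :=
    hHU.mono_set (uIcc_subset_uIcc left_mem_uIcc (by rwa [uIcc_of_le hτ]))
  ext a b
  rw [hU.eq_integral s hs a b, intervalIntegral.integral_smul, Matrix.add_apply, Matrix.smul_apply,
    intervalIntegral_matrix_apply hs', smul_eq_mul]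
  ring

/-- Duhamel's formula for two Hamiltonians. -/
theorem star_mul_propagator {H₁ H₂ U₁ U₂ : ℝ → Matrix n n ℂ} {τ : ℝ} (hτ : 0 ≤ τ)
    (hH₁ : ∀ s, (H₁ s).IsHermitian)
    (hI₁ : IntervalIntegrable H₁ volume 0 τ) (hI₂ : IntervalIntegrable H₂ volume 0 τ)
    (hc₁ : ContinuousOn U₁ (Icc 0 τ)) (hc₂ : ContinuousOn U₂ (Icc 0 τ))
    (h₁ : ∀ s ∈ Icc 0 τ, U₁ s = 1 + ∫ r in (0 : ℝ)..s, (-Complex.I) • (H₁ r * U₁ r))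
    (h₂ : ∀ s ∈ Icc 0 τ, U₂ s = 1 + ∫ r in (0 : ℝ)..s, (-Complex.I) • (H₂ r * U₂ r)) :
    star (U₁ τ) * U₂ τ =
      1 + ∫ r in (0 : ℝ)..τ, star (U₁ r) * ((-Complex.I) • (H₂ r - H₁ r)) * U₂ r := by
  rw [← uIcc_of_le hτ] at hc₁ hc₂
  have hHU₁ : IntervalIntegrable (fun r => (-Complex.I) • (H₁ r * U₁ r)) volume 0 τ :=
    (hI₁.mul_continuousOn hc₁).smul (-Complex.I)
  have hHU₂ : IntervalIntegrable (fun r => (-Complex.I) • (H₂ r * U₂ r)) volume 0 τ :=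
    (hI₂.mul_continuousOn hc₂).smul (-Complex.I)
  have hstar : IntervalIntegrable (fun r => star ((-Complex.I) • (H₁ r * U₁ r))) volume 0 τ :=
    ⟨(starL' ℝ : Matrix n n ℂ ≃L[ℝ] Matrix n n ℂ).toContinuousLinearMap.integrable_comp hHU₁.1,
      (starL' ℝ : Matrix n n ℂ ≃L[ℝ] Matrix n n ℂ).toContinuousLinearMap.integrable_comp hHU₁.2⟩
  have key := primitive_mul_primitive (u := fun s => star (U₁ s)) (v := U₂) (a := 1) (b := 1) hτ
    hstar hHU₂ (fun s hs => by
      rw [intervalIntegral_star (hHU₁.mono_set (uIcc_subset_uIcc left_mem_uIcc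
        (by rwa [uIcc_of_le hτ]))), h₁ s hs, star_add, star_one]) h₂
  rw [key, one_mul]
  congr 1
  refine intervalIntegral.integral_congr fun r _ => ?_
  have hs : star (H₁ r) = H₁ r := hH₁ r
  simp only [star_smul, star_mul, hs, Matrix.smul_mul, Matrix.mul_smul, mul_sub, sub_mul, smul_sub,
    star_neg, Complex.star_def, Complex.conj_I, mul_assoc]
  module

end propagators

/-! ### Sensitivity of the controlled evolution to the parameters -/

section evolution

open scoped Matrix.Norms.L2Operator

variable {n : Type*} [Fintype n] [DecidableEq n]

theorem IsPropagator.mem_unitaryGroup {H U : ℝ → Matrix n n ℂ} {τ : ℝ} (hτ : 0 ≤ τ)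
    (hHerm : ∀ s, (H s).IsHermitian) (hH : IntervalIntegrable H volume 0 τ)
    (hU : IsPropagator H τ U) : U τ ∈ Matrix.unitaryGroup n ℂ := by
  have h := hU.eq_matrix_integral hH hτ
  rw [Matrix.mem_unitaryGroup_iff',
    star_mul_propagator hτ hHerm hH hH hU.continuousOn hU.continuousOn h h]
  simp

/-- Multiplying a propagator by the phase `e^{ics}` shifts the Hamiltonian by `-c`. -/
theorem phase_smul_propagator {H U : ℝ → Matrix n n ℂ} {τ c : ℝ}
    (hH : IntervalIntegrable H volume 0 τ) (hc : ContinuousOn U (Icc 0 τ))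
    (hU : ∀ s ∈ Icc 0 τ, U s = 1 + ∫ r in (0 : ℝ)..s, (-Complex.I) • (H r * U r)) :
    ∀ s ∈ Icc 0 τ, Complex.exp (Complex.I * c * s) • U s = 1 + ∫ r in (0 : ℝ)..s,
      (-Complex.I) • ((H r - (c : ℂ) • 1) * (Complex.exp (Complex.I * c * r) • U r)) := by
  intro s hs
  have hsub : Icc 0 s ⊆ Icc 0 τ := Icc_subset_Icc_right hs.2
  have hH' : IntervalIntegrable H volume 0 s :=
    hH.mono_set (uIcc_subset_uIcc left_mem_uIcc (by rwa [uIcc_of_le (hs.1.trans hs.2)]))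
  have hderiv : ∀ r : ℝ, HasDerivAt (fun r : ℝ => Complex.exp (Complex.I * c * r) •
      (1 : Matrix n n ℂ)) ((Complex.exp (Complex.I * c * r) * (Complex.I * c)) • 1) r := by
    intro r
    have h1 : HasDerivAt (fun r : ℝ => Complex.I * c * r) (Complex.I * c) r := by
      simpa using (Complex.ofRealCLM.hasDerivAt (x := r)).const_mul (Complex.I * c)
    exact h1.cexp.smul_const 1
  have hcont : Continuous fun r : ℝ =>
      (Complex.exp (Complex.I * c * r) * (Complex.I * c)) • (1 : Matrix n n ℂ) := by fun_prop
  have key := primitive_mul_primitive (u := fun r : ℝ => Complex.exp (Complex.I * c * r) •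
      (1 : Matrix n n ℂ)) (v := U) (a := 1) (b := 1)
    (u' := fun r => (Complex.exp (Complex.I * c * r) * (Complex.I * c)) • 1) hs.1
    (hcont.intervalIntegrable _ _)
    ((hH'.mul_continuousOn (by rw [uIcc_of_le hs.1]; exact hc.mono hsub)).smul (-Complex.I))
    (fun r _ => by
      rw [intervalIntegral.integral_eq_sub_of_hasDerivAt (fun x _ => hderiv x)
        (hcont.intervalIntegrable _ _)]
      simp)
    (fun r hr => hU r (hsub hr))
  simp only [Matrix.smul_mul, one_mul] at key
  rw [key]
  congr 1
  refine intervalIntegral.integral_congr fun r _ => ?_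
  simp only [sub_mul, Matrix.smul_mul, Matrix.mul_smul, one_mul, Pi.smul_apply]
  module

/-- If the Hamiltonians of two propagators differ by the constant `K`, then after removing the
phase `e^{-icτ}` they differ in operator norm by at most `τ ‖K - c‖`. -/
theorem norm_phase_smul_propagator_sub_le {H₁ H₂ U₁ U₂ : ℝ → Matrix n n ℂ} {K : Matrix n n ℂ}
    {τ c : ℝ} (hτ : 0 ≤ τ) (hHerm₁ : ∀ s, (H₁ s).IsHermitian) (hHerm₂ : ∀ s, (H₂ s).IsHermitian)
    (hH₁ : IntervalIntegrable H₁ volume 0 τ) (hH₂ : IntervalIntegrable H₂ volume 0 τ)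
    (hK : ∀ s, H₂ s - H₁ s = K) (hU₁ : IsPropagator H₁ τ U₁) (hU₂ : IsPropagator H₂ τ U₂) :
    ‖Complex.exp (Complex.I * c * τ) • U₂ τ - U₁ τ‖ ≤ τ * ‖K - (c : ℂ) • 1‖ := by
  have hmono : ∀ {H U : ℝ → Matrix n n ℂ}, (∀ s, (H s).IsHermitian) →
      IntervalIntegrable H volume 0 τ → IsPropagator H τ U →
      ∀ s ∈ Icc 0 τ, U s ∈ Matrix.unitaryGroup n ℂ := fun hHerm hH hU s hs =>
    IsPropagator.mem_unitaryGroup hs.1 hHerm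
      (hH.mono_set (uIcc_subset_uIcc left_mem_uIcc (by rwa [uIcc_of_le hτ])))
      ⟨hU.continuousOn.mono (Icc_subset_Icc_right hs.2),
        fun r hr => hU.eq_integral r ⟨hr.1, hr.2.trans hs.2⟩⟩
  have hphase : ∀ s : ℝ, ‖Complex.exp (Complex.I * c * s)‖ = 1 := fun s => by
    rw [mul_assoc, ← Complex.ofReal_mul, mul_comm, Complex.norm_exp_ofReal_mul_I]
  have hUτ := hmono hHerm₁ hH₁ hU₁ τ ⟨hτ, le_rfl⟩
  have hcV : ContinuousOn (fun s : ℝ => Complex.exp (Complex.I * c * s) • U₂ s) (Icc 0 τ) :=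
    ContinuousOn.smul (f := fun s : ℝ => Complex.exp (Complex.I * c * s)) (by fun_prop)
      hU₂.continuousOn
  have key := star_mul_propagator (U₂ := fun s : ℝ => Complex.exp (Complex.I * c * s) • U₂ s)
    hτ hHerm₁ hH₁ (hH₂.sub intervalIntegrable_const) hU₁.continuousOn hcV
    (hU₁.eq_matrix_integral hH₁ hτ)
    (phase_smul_propagator hH₂ hU₂.continuousOn (hU₂.eq_matrix_integral hH₂ hτ))
  have hstar : star (U₁ τ) ∈ unitary (Matrix n n ℂ) := Unitary.star_mem hUτ
  rw [← CStarRing.norm_mem_unitary_mul _ hstar, mul_sub, Matrix.mem_unitaryGroup_iff'.mp hUτ, key,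
    add_sub_cancel_left]
  refine (intervalIntegral.norm_integral_le_of_norm_le_const
    (C := ‖K - (c : ℂ) • 1‖) fun r hr => ?_).trans_eq ?_
  · rw [uIoc_of_le hτ] at hr
    have hr' : r ∈ Icc 0 τ := ⟨hr.1.le, hr.2⟩
    rw [Matrix.mul_smul, norm_smul, hphase, one_mul,
      CStarRing.norm_mul_mem_unitary _ (hmono hHerm₂ hH₂ hU₂ r hr'),
      CStarRing.norm_mem_unitary_mul _ (Unitary.star_mem (hmono hHerm₁ hH₁ hU₁ r hr')),
      norm_smul, norm_neg, Complex.norm_I, one_mul, sub_right_comm, hK]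
  · rw [sub_zero, abs_of_nonneg hτ, mul_comm]

/-- The midpoint between the extreme eigenvalues of a Hermitian matrix. -/
noncomputable def spectralCenter (G : Matrix n n ℂ) : ℝ :=
  (sSup (spectrum ℝ G) + sInf (spectrum ℝ G)) / 2

/-- Subtracting the spectral centre makes the operator norm half of the seminorm. This is where the
bound gains over the unshifted norm; the shift costs only a phase. -/
theorem norm_kronecker_one_sub_le {N d : ℕ} (hN : 0 < N) {G : Matrix (Fin N) (Fin N) ℂ}
    (hG : G.IsHermitian) :
    ‖G ⊗ₖ (1 : Matrix (Fin d) (Fin d) ℂ) - (spectralCenter G : ℂ) • 1‖ ≤ opSeminorm G / 2 := by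
  have hfin := Matrix.finite_real_spectrum (𝕜 := ℂ) (A := G)
  set V : Matrix (Fin N) (Fin N) ℂ := ↑hG.eigenvectorUnitary with hV
  have hVmem : V ∈ unitary (Matrix (Fin N) (Fin N) ℂ) := hG.eigenvectorUnitary.2
  set W : Matrix (Fin N × Fin d) (Fin N × Fin d) ℂ := V ⊗ₖ 1 with hW
  have hWmem : W ∈ unitary (Matrix (Fin N × Fin d) (Fin N × Fin d) ℂ) :=
    Matrix.kronecker_mem_unitary hVmem (one_mem _)
  have hGV : G = V * Matrix.diagonal (fun i => (hG.eigenvalues i : ℂ)) * star V := by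
    conv_lhs => rw [hG.spectral_theorem, Unitary.conjStarAlgAut_apply]
    rfl
  have hdecomp : G ⊗ₖ (1 : Matrix (Fin d) (Fin d) ℂ) - (spectralCenter G : ℂ) • 1 =
      W * Matrix.diagonal (fun p : Fin N × Fin d =>
        ((hG.eigenvalues p.1 - spectralCenter G : ℝ) : ℂ)) * star W := by
    have h1 : Matrix.diagonal (fun p : Fin N × Fin d =>
        ((hG.eigenvalues p.1 - spectralCenter G : ℝ) : ℂ)) =
        Matrix.diagonal (fun i => (hG.eigenvalues i : ℂ)) ⊗ₖ (1 : Matrix (Fin d) (Fin d) ℂ) -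
          (spectralCenter G : ℂ) • 1 := by
      rw [← Matrix.diagonal_one, Matrix.diagonal_kronecker_diagonal, ← Matrix.diagonal_one,
        ← Matrix.diagonal_smul, Matrix.diagonal_sub]
      congr 1
      ext p
      simp
    rw [h1, mul_sub, sub_mul, Matrix.mul_smul, Matrix.smul_mul, mul_one,
      Unitary.mul_star_self_of_mem hWmem]
    congr 1
    conv_lhs => rw [hGV]
    rw [hW, Matrix.star_eq_conjTranspose, Matrix.star_eq_conjTranspose,
      Matrix.conjTranspose_kronecker, ← Matrix.mul_kronecker_mul, ← Matrix.mul_kronecker_mul]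
    simp
  rw [hdecomp, CStarRing.norm_mul_mem_unitary _ (Unitary.star_mem hWmem),
    CStarRing.norm_mem_unitary_mul _ hWmem, Matrix.l2_opNorm_diagonal]
  refine (pi_norm_le_iff_of_nonneg (div_nonneg (opSeminorm_nonneg hN hG) two_pos.le)).mpr
    fun p => ?_
  have h1 := csInf_le hfin.bddBelow (hG.eigenvalues_mem_spectrum_real p.1)
  have h2 := le_csSup hfin.bddAbove (hG.eigenvalues_mem_spectrum_real p.1)
  rw [Complex.norm_real, Real.norm_eq_abs, abs_le, spectralCenter, opSeminorm]
  constructor <;> linarith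

theorem ControlledEvolution.nonneg {N m d : ℕ} {g : Fin m → Matrix (Fin N) (Fin N) ℂ} {t : ℝ}
    {U : (Fin m → ℝ) → Matrix (Fin N × Fin d) (Fin N × Fin d) ℂ}
    (h : ControlledEvolution g t U) : 0 ≤ t := by
  induction h with
  | drive τ hτ => exact hτ
  | gate => exact le_rfl
  | comp _ _ h₁ h₂ => exact add_nonneg h₁ h₂

theorem isHermitian_kronecker_one_add {N m d : ℕ} {g : Fin m → Matrix (Fin N) (Fin N) ℂ}
    (hg : ∀ j, (g j).IsHermitian) {Hc : Matrix (Fin N × Fin d) (Fin N × Fin d) ℂ}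
    (hHc : Hc.IsHermitian) (θ : Fin m → ℝ) :
    (lincomb θ g ⊗ₖ (1 : Matrix (Fin d) (Fin d) ℂ) + Hc).IsHermitian := by
  refine Matrix.IsHermitian.add ?_ hHc
  rw [Matrix.IsHermitian, Matrix.conjTranspose_kronecker, (isHermitian_lincomb hg θ).eq,
    Matrix.conjTranspose_one]

theorem ControlledEvolution.mem_unitaryGroup {N m d : ℕ} {g : Fin m → Matrix (Fin N) (Fin N) ℂ}
    (hg : ∀ j, (g j).IsHermitian) {t : ℝ}
    {U : (Fin m → ℝ) → Matrix (Fin N × Fin d) (Fin N × Fin d) ℂ}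
    (h : ControlledEvolution g t U) (θ : Fin m → ℝ) :
    U θ ∈ Matrix.unitaryGroup (Fin N × Fin d) ℂ := by
  induction h with
  | drive τ hτ Hc hHerm hInt U hU =>
    exact (hU θ).mem_unitaryGroup hτ (fun s => isHermitian_kronecker_one_add hg (hHerm s) θ)
      (intervalIntegrable_const.add (intervalIntegrable_matrix hInt))
  | gate V hV => exact hV
  | comp _ _ h₁ h₂ => exact mul_mem h₂ h₁

/-- Up to a global phase, the implemented unitary depends on the parameter in a Lipschitz way, at
rate `t` times the norm of the change of the generator, shifted by any constant `c`. -/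
theorem ControlledEvolution.norm_phase_smul_sub_le {N m d : ℕ}
    {g : Fin m → Matrix (Fin N) (Fin N) ℂ} (hg : ∀ j, (g j).IsHermitian) {t : ℝ}
    {U : (Fin m → ℝ) → Matrix (Fin N × Fin d) (Fin N × Fin d) ℂ}
    (h : ControlledEvolution g t U) (θ v : Fin m → ℝ) (c : ℝ) :
    ‖Complex.exp (Complex.I * c * t) • U (θ + v) - U θ‖ ≤
      t * ‖lincomb v g ⊗ₖ (1 : Matrix (Fin d) (Fin d) ℂ) - (c : ℂ) • 1‖ := by
  induction h with
  | drive τ hτ Hc hHerm hInt U hU =>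
    have hI : ∀ θ : Fin m → ℝ, IntervalIntegrable
        (fun s => lincomb θ g ⊗ₖ (1 : Matrix (Fin d) (Fin d) ℂ) + Hc s) volume 0 τ := fun θ =>
      intervalIntegrable_const.add (intervalIntegrable_matrix hInt)
    refine norm_phase_smul_propagator_sub_le (K := lincomb v g ⊗ₖ (1 : Matrix (Fin d) (Fin d) ℂ))
      hτ (fun s => isHermitian_kronecker_one_add hg (hHerm s) θ)
      (fun s => isHermitian_kronecker_one_add hg (hHerm s) (θ + v)) (hI θ) (hI (θ + v))
      (fun s => ?_) (hU θ) (hU (θ + v))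
    have hadd : lincomb (θ + v) g = lincomb θ g + lincomb v g := by
      simp [lincomb, add_smul, Finset.sum_add_distrib]
    rw [hadd, Matrix.add_kronecker]
    abel
  | gate V hV => simp
  | @comp t₁ t₂ U₁ U₂ h₁ h₂ ih₁ ih₂ =>
    have hphase : ‖Complex.exp (Complex.I * c * t₁)‖ = 1 := by
      rw [mul_assoc, ← Complex.ofReal_mul, mul_comm, Complex.norm_exp_ofReal_mul_I]
    have hsplit : Complex.exp (Complex.I * c * ((t₁ + t₂ : ℝ) : ℂ)) •
          (U₂ (θ + v) * U₁ (θ + v)) - U₂ θ * U₁ θ =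
        Complex.exp (Complex.I * c * t₁) •
          ((Complex.exp (Complex.I * c * t₂) • U₂ (θ + v) - U₂ θ) * U₁ (θ + v)) +
          U₂ θ * (Complex.exp (Complex.I * c * t₁) • U₁ (θ + v) - U₁ θ) := by
      rw [Complex.ofReal_add, mul_add, Complex.exp_add]
      simp only [sub_mul, mul_sub, Matrix.smul_mul, Matrix.mul_smul, smul_sub]
      module
    rw [hsplit, add_mul, add_comm (t₁ * _)]
    refine (norm_add_le _ _).trans (add_le_add ?_ ?_)
    · rw [norm_smul, hphase, one_mul, CStarRing.norm_mul_mem_unitary _ (h₁.mem_unitaryGroup hg _)]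
      exact ih₂
    · rw [CStarRing.norm_mem_unitary_mul _ (h₂.mem_unitaryGroup hg _)]
      exact ih₁

/-- Left multiplication is bounded in Frobenius norm by the operator norm. -/
theorem trace_mul_conjTranspose_le (X C : Matrix n n ℂ) :
    ((X * C) * (X * C)ᴴ).trace.re ≤ ‖X‖ ^ 2 * (C * Cᴴ).trace.re := by
  have hcol : ∀ B : Matrix n n ℂ, (B * Bᴴ).trace.re =
      ∑ j, ‖WithLp.toLp 2 (fun i => B i j)‖ ^ 2 := by
    intro B
    rw [trace_mul_conjTranspose_self, Complex.ofReal_re, Finset.sum_comm]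
    simp [EuclideanSpace.norm_sq_eq]
  rw [hcol, hcol, Finset.mul_sum]
  refine Finset.sum_le_sum fun j _ => ?_
  rw [← mul_pow]
  have := Matrix.l2_opNorm_mulVec X (WithLp.toLp 2 fun i => C i j)
  exact pow_le_pow_left₀ (norm_nonneg _) this 2

end evolution

/-! ### Outcome distributions and the Cauchy–Schwarz inequality -/

section born

/-- The quadratic form `B ↦ Re Tr (B Bᴴ M)` at a real combination of two matrices, with the mixed
term written through its value at the sum. -/
theorem trace_smul_add_mul_conjTranspose {n : Type*} [Fintype n]
    (A D M : Matrix n n ℂ) (y z : ℝ) :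
    ((y • A + z • D) * (y • A + z • D)ᴴ * M).trace.re =
      y ^ 2 * (A * Aᴴ * M).trace.re + y * z * ((A + D) * (A + D)ᴴ * M).trace.re
        - y * z * (A * Aᴴ * M).trace.re - y * z * (D * Dᴴ * M).trace.re
        + z ^ 2 * (D * Dᴴ * M).trace.re := by
  simp only [Matrix.conjTranspose_add, Matrix.conjTranspose_smul, star_trivial, Matrix.add_mul,
    Matrix.mul_add, Matrix.smul_mul, Matrix.mul_smul, Matrix.trace_add, Matrix.trace_smul,
    Complex.add_re, Complex.smul_re, smul_eq_mul]
  ring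

variable {X : Type*} [MeasurableSpace X] {n : Type*} [Fintype n] [DecidableEq n]

/-- The outcome distribution of the unnormalized state `B Bᴴ`, as a function of `B`. -/
noncomputable def bornMeasure (E : POVM X n) (B : Matrix n n ℂ) : Measure X :=
  E.distribution (B * Bᴴ) (Matrix.posSemidef_self_mul_conjTranspose B)

variable (E : POVM X n)

theorem bornMeasure_apply (B : Matrix n n ℂ) {s : Set X} (hs : MeasurableSet s) :
    bornMeasure E B s = ENNReal.ofReal (B * Bᴴ * E.effect s).trace.re := by
  rw [bornMeasure, POVM.distribution, Measure.ofMeasurable_apply s hs]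

instance (B : Matrix n n ℂ) : IsFiniteMeasure (bornMeasure E B) :=
  ⟨by rw [bornMeasure_apply E B .univ]; exact ENNReal.ofReal_lt_top⟩

theorem bornMeasure_real_apply (B : Matrix n n ℂ) {s : Set X} (hs : MeasurableSet s) :
    (bornMeasure E B).real s = (B * Bᴴ * E.effect s).trace.re := by
  rw [Measure.real, bornMeasure_apply E B hs, ENNReal.toReal_ofReal]
  exact trace_mul_re_nonneg (Matrix.posSemidef_self_mul_conjTranspose B) (E.posSemidef s hs)

theorem bornMeasure_real_univ (B : Matrix n n ℂ) :
    (bornMeasure E B).real univ = (B * Bᴴ).trace.re := by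
  rw [bornMeasure_real_apply E B .univ, E.effect_univ, mul_one]

theorem measure_ext_real {μ ν : Measure X} [IsFiniteMeasure μ] [IsFiniteMeasure ν]
    (h : ∀ s, MeasurableSet s → μ.real s = ν.real s) : μ = ν :=
  Measure.ext fun s hs => (measureReal_eq_measureReal_iff).mp (h s hs)

theorem bornMeasure_smul (y : ℝ) (B : Matrix n n ℂ) :
    bornMeasure E (y • B) = (y ^ 2).toNNReal • bornMeasure E B := by
  refine measure_ext_real fun s hs => ?_
  have h := trace_smul_add_mul_conjTranspose B 0 (E.effect s) y 0
  simp only [smul_zero, add_zero, mul_zero, zero_mul, sub_zero, ne_eq, OfNat.ofNat_ne_zero,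
    not_false_eq_true, zero_pow] at h
  rw [bornMeasure_real_apply E _ hs, measureReal_nnreal_smul_apply, bornMeasure_real_apply E _ hs,
    Real.coe_toNNReal _ (sq_nonneg y), h]

theorem bornMeasure_add_add_sub (A D : Matrix n n ℂ) :
    bornMeasure E (A + D) + bornMeasure E (A - D) =
      (2 : NNReal) • bornMeasure E A + (2 : NNReal) • bornMeasure E D := by
  refine measure_ext_real fun s hs => ?_
  have h := trace_smul_add_mul_conjTranspose A D (E.effect s) 1 (-1)
  simp only [one_smul, neg_smul, ← sub_eq_add_neg] at h
  rw [measureReal_add_apply, measureReal_add_apply]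
  simp only [measureReal_nnreal_smul_apply, bornMeasure_real_apply E _ hs]
  rw [h]
  push_cast
  ring

/-- The parallelogram law, in the weighted form that expresses convexity. -/
theorem bornMeasure_convex (A D : Matrix n n ℂ) {a b : ℝ} (ha : 0 ≤ a) (hb : 0 ≤ b)
    (hab : a + b = 1) :
    bornMeasure E (a • A + b • D) + (a * b).toNNReal • bornMeasure E (A - D) =
      a.toNNReal • bornMeasure E A + b.toNNReal • bornMeasure E D := by
  refine measure_ext_real fun s hs => ?_
  have h := trace_smul_add_mul_conjTranspose A D (E.effect s) 1 (-1)
  have h' := trace_smul_add_mul_conjTranspose A D (E.effect s) a b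
  simp only [one_smul, neg_smul, ← sub_eq_add_neg] at h
  rw [measureReal_add_apply, measureReal_add_apply]
  simp only [measureReal_nnreal_smul_apply, bornMeasure_real_apply E _ hs,
    Real.coe_toNNReal _ ha, Real.coe_toNNReal _ hb, Real.coe_toNNReal _ (mul_nonneg ha hb)]
  rw [h, h']
  obtain rfl : b = 1 - a := by linarith
  ring

theorem bornMeasure_add_le (A D : Matrix n n ℂ) :
    bornMeasure E (A + D) ≤ (2 : NNReal) • bornMeasure E A + (2 : NNReal) • bornMeasure E D :=
  (Measure.le_add_right le_rfl).trans_eq (bornMeasure_add_add_sub E A D)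

/-- The directions `B` against whose outcome distribution `f` is integrable form a subspace. -/
noncomputable def integrableSubmodule (f : X → ℝ) : Submodule ℝ (Matrix n n ℂ) where
  carrier := {B | Integrable f (bornMeasure E B)}
  zero_mem' := by
    have : bornMeasure E 0 = 0 := by simpa using bornMeasure_smul E 0 0
    simp [this]
  add_mem' := fun {A D} hA hD =>
    ((hA.smul_measure_nnreal (c := 2)).add_measure (hD.smul_measure_nnreal (c := 2))).mono_measure
      (bornMeasure_add_le E A D)
  smul_mem' := fun y B hB => by
    change Integrable f (bornMeasure E (y • B))
    rw [bornMeasure_smul]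
    exact hB.smul_measure_nnreal

theorem mem_integrableSubmodule {f : X → ℝ} {B : Matrix n n ℂ} :
    B ∈ integrableSubmodule E f ↔ Integrable f (bornMeasure E B) := Iff.rfl

/-- `B ↦ ∫ |f|` is the square of a seminorm, hence convex. -/
theorem convexOn_integral_norm (f : X → ℝ) :
    ConvexOn ℝ univ fun B : integrableSubmodule E f =>
      ∫ x, ‖f x‖ ∂(bornMeasure E (B : Matrix n n ℂ)) := by
  refine ⟨convex_univ, fun A _ D _ a b ha hb hab => ?_⟩
  have hA := ((mem_integrableSubmodule E).mp A.2).norm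
  have hD := ((mem_integrableSubmodule E).mp D.2).norm
  have hAD : Integrable (fun x => ‖f x‖)
      (bornMeasure E (a • (A : Matrix n n ℂ) + b • (D : Matrix n n ℂ))) :=
    ((mem_integrableSubmodule E).mp (a • A + b • D).2).norm
  have hsub : Integrable (fun x => ‖f x‖) (bornMeasure E ((A : Matrix n n ℂ) - D)) :=
    ((mem_integrableSubmodule E).mp (A - D).2).norm
  have h := congrArg (fun μ => ∫ x, ‖f x‖ ∂μ)
    (bornMeasure_convex E (A : Matrix n n ℂ) D ha hb hab)
  rw [integral_add_measure hAD hsub.smul_measure_nnreal,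
    integral_add_measure hA.smul_measure_nnreal hD.smul_measure_nnreal,
    integral_smul_nnreal_measure, integral_smul_nnreal_measure, integral_smul_nnreal_measure] at h
  simp only [NNReal.smul_def, Real.coe_toNNReal _ ha, Real.coe_toNNReal _ hb,
    Real.coe_toNNReal _ (mul_nonneg ha hb)] at h
  have h0 : 0 ≤ (a * b) • ∫ x, ‖f x‖ ∂(bornMeasure E ((A : Matrix n n ℂ) - D)) :=
    smul_nonneg (mul_nonneg ha hb) (integral_nonneg fun _ => norm_nonneg _)
  change ∫ x, ‖f x‖ ∂(bornMeasure E (a • (A : Matrix n n ℂ) + b • (D : Matrix n n ℂ))) ≤ _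
  linarith

open scoped Matrix.Norms.Frobenius in
/-- A convex function on a finite-dimensional space is bounded on the unit sphere, so the
2-homogeneous function `B ↦ ∫ |f|` is at most quadratic in the Frobenius norm. -/
theorem exists_abs_integral_le (f : X → ℝ) :
    ∃ C : ℝ, ∀ B : Matrix n n ℂ, Integrable f (bornMeasure E B) →
      |∫ x, f x ∂(bornMeasure E B)| ≤ C * (B * Bᴴ).trace.re := by
  have hfrob : ∀ B : Matrix n n ℂ, ‖B‖ ^ 2 = (B * Bᴴ).trace.re := by
    intro B
    rw [trace_mul_conjTranspose_self, Complex.ofReal_re, Matrix.frobenius_norm_def,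
      ← Real.sqrt_eq_rpow, Real.sq_sqrt (by positivity)]
    simp
  have hcont := continuousOn_univ.mp ((convexOn_integral_norm E f).continuousOn isOpen_univ)
  have : ProperSpace (integrableSubmodule E f) := FiniteDimensional.proper ℝ _
  obtain ⟨C, hC⟩ := (isCompact_sphere (0 : integrableSubmodule E f) 1).exists_bound_of_continuousOn
    hcont.continuousOn
  refine ⟨C, fun B hB => ?_⟩
  refine (abs_integral_le_integral_abs).trans ?_
  rw [← hfrob]
  rcases eq_or_ne B 0 with rfl | h0
  · have : bornMeasure E 0 = 0 := by simpa using bornMeasure_smul E 0 0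
    simp [this]
  have hnorm : ‖B‖ ≠ 0 := norm_ne_zero_iff.mpr h0
  let u : integrableSubmodule E f := ‖B‖⁻¹ • ⟨B, hB⟩
  have hu : u ∈ Metric.sphere (0 : integrableSubmodule E f) 1 := by
    rw [mem_sphere_zero_iff_norm, norm_smul, norm_inv, norm_norm]
    exact inv_mul_cancel₀ hnorm
  have h1 := (le_abs_self _).trans (hC u hu)
  have h2 : B = ‖B‖ • (u : Matrix n n ℂ) := by
    change B = ‖B‖ • (‖B‖⁻¹ • B)
    rw [smul_inv_smul₀ hnorm]
  conv_lhs => rw [h2]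
  rw [bornMeasure_smul, integral_smul_nnreal_measure, NNReal.smul_def,
    Real.coe_toNNReal _ (sq_nonneg _), smul_eq_mul, mul_comm]
  exact mul_le_mul_of_nonneg_right h1 (sq_nonneg _)

/-- The Cauchy–Schwarz inequality for the polar form of `B ↦ ∫ f d(bornMeasure E B)`. On densities
with respect to a common dominating measure, the quadratic polynomial
`y ↦ d(bornMeasure E (y • A + D))` is almost everywhere nonnegative, and `y` may be replaced by a
multiple of `f x`. -/
theorem sq_polar_integral_le {f : X → ℝ} {A D : Matrix n n ℂ}
    (hA : MemLp f 2 (bornMeasure E A)) (hD : Integrable f (bornMeasure E D)) :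
    (∫ x, f x ∂(bornMeasure E (A + D)) - ∫ x, f x ∂(bornMeasure E A)
        - ∫ x, f x ∂(bornMeasure E D)) ^ 2 ≤
      4 * (∫ x, f x ^ 2 ∂(bornMeasure E A)) * (D * Dᴴ).trace.re := by
  have hA1 : Integrable f (bornMeasure E A) := hA.integrable one_le_two
  have hA2 : Integrable (fun x => f x ^ 2) (bornMeasure E A) := hA.integrable_sq
  have hAD : Integrable f (bornMeasure E (A + D)) :=
    (integrableSubmodule E f).add_mem hA1 hD
  set ν : Measure X := bornMeasure E A + bornMeasure E D with hν
  have acA : bornMeasure E A ≪ ν := (Measure.le_add_right le_rfl).absolutelyContinuous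
  have acD : bornMeasure E D ≪ ν := (Measure.le_add_left le_rfl).absolutelyContinuous
  have acAD : bornMeasure E (A + D) ≪ ν := by
    have h : bornMeasure E (A + D) ≤ (2 : NNReal) • ν :=
      (bornMeasure_add_le E A D).trans_eq (smul_add _ _ _).symm
    exact h.absolutelyContinuous.trans (Measure.smul_absolutelyContinuous)
  set a : X → ℝ := fun x => ((bornMeasure E A).rnDeriv ν x).toReal with ha
  set b : X → ℝ := fun x => ((bornMeasure E D).rnDeriv ν x).toReal with hb
  set c : X → ℝ := fun x => ((bornMeasure E (A + D)).rnDeriv ν x).toReal with hc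
  have ia : Integrable a ν := Measure.integrable_toReal_rnDeriv
  have ib : Integrable b ν := Measure.integrable_toReal_rnDeriv
  have ic : Integrable c ν := Measure.integrable_toReal_rnDeriv
  have hy : ∀ y : ℝ, ∀ᵐ x ∂ν, 0 ≤ y ^ 2 * a x + y * (c x - a x - b x) + b x := by
    intro y
    have i1 : Integrable (fun x => y ^ 2 * a x) ν := ia.const_mul _
    have i2 : Integrable (fun x => y * (c x - a x - b x)) ν := ((ic.sub ia).sub ib).const_mul _
    refine ae_nonneg_of_forall_setIntegral_nonneg ((i1.add i2).add ib) fun s hs _ => ?_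
    have i12 : Integrable (fun x => y ^ 2 * a x + y * (c x - a x - b x)) ν := i1.add i2
    have ica : Integrable (fun x => c x - a x) ν := ic.sub ia
    have e : ∫ x in s, (y ^ 2 * a x + y * (c x - a x - b x) + b x) ∂ν =
        y ^ 2 * (bornMeasure E A).real s + y * ((bornMeasure E (A + D)).real s
          - (bornMeasure E A).real s - (bornMeasure E D).real s) + (bornMeasure E D).real s := by
      rw [integral_add i12.integrableOn ib.integrableOn,
        integral_add i1.integrableOn i2.integrableOn, integral_const_mul, integral_const_mul,
        integral_sub ica.integrableOn ib.integrableOn,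
        integral_sub ic.integrableOn ia.integrableOn, Measure.setIntegral_toReal_rnDeriv acA,
        Measure.setIntegral_toReal_rnDeriv acD, Measure.setIntegral_toReal_rnDeriv acAD]
    rw [e]
    have h := trace_smul_add_mul_conjTranspose A D (E.effect s) y 1
    simp only [bornMeasure_real_apply E _ hs]
    refine (trace_mul_re_nonneg (Matrix.posSemidef_self_mul_conjTranspose (y • A + (1 : ℝ) • D))
      (E.posSemidef s hs)).trans_eq (h.trans ?_)
    ring
  -- the inequality passes from rational `y` to all real `y` by continuity
  have hall : ∀ᵐ x ∂ν, ∀ y : ℝ, 0 ≤ y ^ 2 * a x + y * (c x - a x - b x) + b x := by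
    filter_upwards [ae_all_iff.mpr fun q : ℚ => hy q] with x hx y
    have hclosed : IsClosed {y : ℝ | 0 ≤ y ^ 2 * a x + y * (c x - a x - b x) + b x} :=
      isClosed_le continuous_const (by fun_prop)
    exact hclosed.closure_subset_iff.mpr (by rintro _ ⟨q, rfl⟩; exact hx q)
      (Rat.denseRange_cast (𝕜 := ℝ) y)
  have i3 : Integrable (fun x => a x * f x ^ 2) ν := (integrable_rnDeriv_smul_iff acA).mpr hA2
  have i4 : Integrable (fun x => a x * f x) ν := (integrable_rnDeriv_smul_iff acA).mpr hA1
  have i5 : Integrable (fun x => b x * f x) ν := (integrable_rnDeriv_smul_iff acD).mpr hD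
  have i6 : Integrable (fun x => c x * f x) ν := (integrable_rnDeriv_smul_iff acAD).mpr hAD
  -- evaluate at `y = r * f x`, integrate, and read off the discriminant in `r`
  have hquad : ∀ r : ℝ, 0 ≤ (∫ x, f x ^ 2 ∂(bornMeasure E A)) * (r * r) +
      (∫ x, f x ∂(bornMeasure E (A + D)) - ∫ x, f x ∂(bornMeasure E A)
        - ∫ x, f x ∂(bornMeasure E D)) * r + (D * Dᴴ).trace.re := by
    intro r
    have h0 : 0 ≤ ∫ x, (r ^ 2 * (a x * f x ^ 2) +
        r * (c x * f x - a x * f x - b x * f x) + b x) ∂ν := by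
      refine integral_nonneg_of_ae ?_
      filter_upwards [hall] with x hx
      refine (hx (r * f x)).trans_eq ?_
      ring
    have i7 : Integrable (fun x => r ^ 2 * (a x * f x ^ 2)) ν := i3.const_mul _
    have i8 : Integrable (fun x => r * (c x * f x - a x * f x - b x * f x)) ν :=
      ((i6.sub i4).sub i5).const_mul _
    have i78 : Integrable (fun x => r ^ 2 * (a x * f x ^ 2) +
        r * (c x * f x - a x * f x - b x * f x)) ν := i7.add i8
    have i64 : Integrable (fun x => c x * f x - a x * f x) ν := i6.sub i4
    rw [integral_add i78 ib, integral_add i7 i8, integral_const_mul, integral_const_mul,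
      integral_sub i64 i5, integral_sub i6 i4] at h0
    have e1 : ∫ x, a x * f x ^ 2 ∂ν = ∫ x, f x ^ 2 ∂(bornMeasure E A) :=
      integral_rnDeriv_smul acA
    have e2 : ∫ x, a x * f x ∂ν = ∫ x, f x ∂(bornMeasure E A) := integral_rnDeriv_smul acA
    have e3 : ∫ x, b x * f x ∂ν = ∫ x, f x ∂(bornMeasure E D) := integral_rnDeriv_smul acD
    have e4 : ∫ x, c x * f x ∂ν = ∫ x, f x ∂(bornMeasure E (A + D)) := integral_rnDeriv_smul acAD
    have e5 : ∫ x, b x ∂ν = (D * Dᴴ).trace.re := by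
      rw [Measure.integral_toReal_rnDeriv acD, bornMeasure_real_univ]
    rw [e1, e2, e3, e4, e5] at h0
    linarith
  have := discrim_le_zero hquad
  rw [discrim] at this
  linarith

/-- Quantum Cramér–Rao inequality along a curve of purifications `A`, where the random variable is
assumed to have a second moment at the base point only. The increment of `∫ f` is the polar part,
bounded by Cauchy–Schwarz, plus a remainder of second order in `A ε - A 0`. -/
theorem abs_deriv_integral_le {f : X → ℝ} {A : ℝ → Matrix n n ℂ} {k δ : ℝ}
    (hk : 0 ≤ k) (hA : MemLp f 2 (bornMeasure E (A 0)))
    (hint : ∀ᶠ ε in 𝓝 0, Integrable f (bornMeasure E (A ε)))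
    (hlip : ∀ ε, ((A ε - A 0) * (A ε - A 0)ᴴ).trace.re ≤ (k * ε) ^ 2)
    (hderiv : HasDerivAt (fun ε => ∫ x, f x ∂(bornMeasure E (A ε))) δ 0) :
    |δ| ≤ 2 * k * √(∫ x, f x ^ 2 ∂(bornMeasure E (A 0))) := by
  obtain ⟨C, hC⟩ := exists_abs_integral_le E f
  set σ := √(∫ x, f x ^ 2 ∂(bornMeasure E (A 0))) with hσ
  have hσ2 : σ ^ 2 = ∫ x, f x ^ 2 ∂(bornMeasure E (A 0)) :=
    Real.sq_sqrt (integral_nonneg fun _ => sq_nonneg _)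
  have hslope := (hasDerivAt_iff_tendsto_slope.mp hderiv).abs
  have hlim : Tendsto (fun ε : ℝ => 2 * k * σ + |C| * k ^ 2 * |ε|) (𝓝[≠] 0)
      (𝓝 (2 * k * σ)) := by
    have : Tendsto (fun ε : ℝ => 2 * k * σ + |C| * k ^ 2 * |ε|) (𝓝 0)
        (𝓝 (2 * k * σ + |C| * k ^ 2 * |0|)) := Continuous.tendsto (by fun_prop) 0
    rw [abs_zero, mul_zero, add_zero] at this
    exact this.mono_left nhdsWithin_le_nhds
  refine le_of_tendsto_of_tendsto hslope hlim ?_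
  filter_upwards [nhdsWithin_le_nhds hint, self_mem_nhdsWithin] with ε hε hne
  have hε0 : (0 : ℝ) < |ε| := abs_pos.mpr hne
  have hD : Integrable f (bornMeasure E (A ε - A 0)) :=
    (integrableSubmodule E f).sub_mem hε (hA.integrable one_le_two)
  have h1 := sq_polar_integral_le E hA hD
  rw [add_sub_cancel, ← hσ2] at h1
  have h2 := hC _ hD
  have h3 := hlip ε
  set I₁ := ∫ x, f x ∂(bornMeasure E (A ε))
  set I₀ := ∫ x, f x ∂(bornMeasure E (A 0))
  set J := ∫ x, f x ∂(bornMeasure E (A ε - A 0))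
  have h4 : |I₁ - I₀ - J| ≤ 2 * σ * (k * |ε|) := by
    refine abs_le_of_sq_le_sq (h1.trans ?_) (by positivity)
    calc 4 * σ ^ 2 * ((A ε - A 0) * (A ε - A 0)ᴴ).trace.re ≤ 4 * σ ^ 2 * (k * ε) ^ 2 := by gcongr
      _ = (2 * σ * (k * |ε|)) ^ 2 := by rw [mul_pow, mul_pow, mul_pow, mul_pow, sq_abs]; ring
  have hpos : 0 ≤ ((A ε - A 0) * (A ε - A 0)ᴴ).trace.re := by
    rw [← bornMeasure_real_univ E]; exact measureReal_nonneg
  have h5 : |J| ≤ |C| * (k * |ε|) ^ 2 := by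
    refine h2.trans ((mul_le_mul_of_nonneg_right (le_abs_self C) hpos).trans ?_)
    rw [mul_pow, sq_abs, ← mul_pow]
    gcongr
  have h6 : |I₁ - I₀| ≤ 2 * σ * (k * |ε|) + |C| * (k * |ε|) ^ 2 := by
    calc |I₁ - I₀| = |(I₁ - I₀ - J) + J| := by rw [sub_add_cancel]
      _ ≤ _ := (abs_add_le _ _).trans (add_le_add h4 h5)
  rw [slope_def_field, sub_zero, abs_div, div_le_iff₀ hε0]
  refine h6.trans_eq ?_
  ring

end born

/-! ### The quantum Cramér–Rao bound -/

section bound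

variable {N m d : ℕ} {X : Type*} [MeasurableSpace X]

theorem distribution_congr {n : Type*} [Fintype n] [DecidableEq n] (E : POVM X n)
    {ρ σ : Matrix n n ℂ} (h : ρ = σ) (hρ : ρ.PosSemidef) (hσ : σ.PosSemidef) :
    E.distribution ρ hρ = E.distribution σ hσ := by
  subst h
  rfl

/-- With `ρ = C Cᴴ`, the outcome law is the Born measure of `z • U C` for every phase `z`. -/
theorem outcomeLaw_eq_bornMeasure {n : Type*} [Fintype n] [DecidableEq n] (E : POVM X n)
    (ρ : DensityMatrix n) {C : Matrix n n ℂ} (hC : ρ.mat = C * Cᴴ)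
    (U : (Fin m → ℝ) → Matrix n n ℂ) (θ : Fin m → ℝ) {z : ℂ} (hz : ‖z‖ = 1) :
    outcomeLaw E ρ U θ = bornMeasure E (z • U θ * C) := by
  refine distribution_congr E ?_ _ _
  have hzz : z * star z = 1 := by
    rw [Complex.star_def, Complex.mul_conj, Complex.normSq_eq_norm_sq, hz]
    simp
  rw [hC, Matrix.conjTranspose_mul, Matrix.conjTranspose_smul]
  simp only [Matrix.smul_mul, Matrix.mul_smul, smul_smul, Matrix.mul_assoc]
  rw [mul_comm, hzz, one_smul]

theorem isProbabilityMeasure_outcomeLaw {n : Type*} [Fintype n] [DecidableEq n] (E : POVM X n)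
    (ρ : DensityMatrix n) (U : (Fin m → ℝ) → Matrix n n ℂ) (θ : Fin m → ℝ)
    (hU : U θ ∈ Matrix.unitaryGroup n ℂ) : IsProbabilityMeasure (outcomeLaw E ρ U θ) := by
  constructor
  rw [outcomeLaw, POVM.distribution, Measure.ofMeasurable_apply _ .univ, E.effect_univ, mul_one,
    Matrix.trace_mul_comm, ← Matrix.mul_assoc, ← Matrix.star_eq_conjTranspose,
    Matrix.mem_unitaryGroup_iff'.mp hU, one_mul, ρ.trace_eq_one]
  simp

open scoped MatrixOrder Matrix.Norms.L2Operator in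
/-- The Cramér–Rao bound for a one-parameter family in the direction `β` with `α · β = 1`. -/
theorem one_le_mul_sqrt_variance (hN : 0 < N) {g : Fin m → Matrix (Fin N) (Fin N) ℂ}
    (hg : ∀ j, (g j).IsHermitian) {t : ℝ} {α β : Fin m → ℝ} (hβ : α ⬝ᵥ β = 1)
    (ρ : DensityMatrix (Fin N × Fin d))
    {U : (Fin m → ℝ) → Matrix (Fin N × Fin d) (Fin N × Fin d) ℂ} (hU : ControlledEvolution g t U)
    (E : POVM X (Fin N × Fin d)) {f : X → ℝ} {θ : Fin m → ℝ}
    (hf : IsLocallyUnbiased (outcomeLaw E ρ U) f α θ)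
    (hL2 : MemLp f 2 (outcomeLaw E ρ U θ)) :
    1 ≤ t * opSeminorm (lincomb β g) * √(Var[f; outcomeLaw E ρ U θ]) := by
  obtain ⟨C, hC⟩ := CStarAlgebra.nonneg_iff_eq_mul_star_self.mp ρ.posSemidef.nonneg
  rw [Matrix.star_eq_conjTranspose] at hC
  have hprob : ∀ θ, IsProbabilityMeasure (outcomeLaw E ρ U θ) := fun θ =>
    isProbabilityMeasure_outcomeLaw E ρ U θ (hU.mem_unitaryGroup hg θ)
  have htr : (C * Cᴴ).trace.re = 1 := by rw [← hC, ρ.trace_eq_one, Complex.one_re]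
  set c := spectralCenter (lincomb β g) with hc
  set S := opSeminorm (lincomb β g) with hS
  have hS0 : 0 ≤ S := opSeminorm_nonneg hN (isHermitian_lincomb hg β)
  have ht := hU.nonneg
  -- the phase that centres the spectrum of the generator of the displacement `ε • β`
  let z : ℝ → ℂ := fun ε => Complex.exp (Complex.I * (ε * c : ℝ) * t)
  have hz : ∀ ε, ‖z ε‖ = 1 := fun ε => by
    change ‖Complex.exp (Complex.I * (ε * c : ℝ) * t)‖ = 1
    rw [mul_assoc, ← Complex.ofReal_mul, mul_comm, Complex.norm_exp_ofReal_mul_I]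
  let A : ℝ → Matrix (Fin N × Fin d) (Fin N × Fin d) ℂ := fun ε => z ε • U (θ + ε • β) * C
  have hlaw : ∀ ε, bornMeasure E (A ε) = outcomeLaw E ρ U (θ + ε • β) := fun ε =>
    (outcomeLaw_eq_bornMeasure E ρ hC U _ (hz ε)).symm
  have hlaw0 : bornMeasure E (A 0) = outcomeLaw E ρ U θ := by
    rw [hlaw, zero_smul, add_zero]
  have hcurve : Tendsto (fun ε : ℝ => θ + ε • β) (𝓝 0) (𝓝 θ) := by
    have : Tendsto (fun ε : ℝ => θ + ε • β) (𝓝 0) (𝓝 (θ + (0 : ℝ) • β)) :=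
      Continuous.tendsto (by fun_prop) 0
    rwa [zero_smul, add_zero] at this
  have hint : ∀ᶠ ε in 𝓝 (0 : ℝ), Integrable f (outcomeLaw E ρ U (θ + ε • β)) :=
    hcurve.eventually hf.integrable
  have hlip : ∀ ε, ((A ε - A 0) * (A ε - A 0)ᴴ).trace.re ≤ (t * (S / 2) * ε) ^ 2 := by
    intro ε
    have h1 : A ε - A 0 = (z ε • U (θ + ε • β) - U θ) * C := by
      simp [A, z, sub_mul]
    have h2 : ‖z ε • U (θ + ε • β) - U θ‖ ≤ t * (S / 2) * |ε| := by
      refine (hU.norm_phase_smul_sub_le hg θ (ε • β) (ε * c)).trans ?_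
      have h3 : lincomb (ε • β) g ⊗ₖ (1 : Matrix (Fin d) (Fin d) ℂ) - ((ε * c : ℝ) : ℂ) • 1 =
          (ε : ℂ) • (lincomb β g ⊗ₖ (1 : Matrix (Fin d) (Fin d) ℂ) - (c : ℂ) • 1) := by
        have : lincomb (ε • β) g = (ε : ℂ) • lincomb β g := by
          simp [lincomb, Finset.smul_sum, mul_smul]
        rw [this, Matrix.smul_kronecker, smul_sub, smul_smul, Complex.ofReal_mul]
      rw [h3, norm_smul, Complex.norm_real, Real.norm_eq_abs, mul_assoc, mul_comm (S / 2)]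
      exact mul_le_mul_of_nonneg_left (mul_le_mul_of_nonneg_left
        (norm_kronecker_one_sub_le hN (isHermitian_lincomb hg β)) (abs_nonneg _)) ht
    rw [h1]
    refine (trace_mul_conjTranspose_le _ _).trans ?_
    rw [htr, mul_one, mul_pow _ ε, ← sq_abs ε, ← mul_pow]
    exact pow_le_pow_left₀ (norm_nonneg _) h2 2
  -- the estimator is centred, so that its second moment at `θ` is the variance
  set μ₀ := ∫ x, f x ∂(outcomeLaw E ρ U θ) with hμ₀
  have hderiv : HasDerivAt (fun ε => ∫ x, (f x - μ₀) ∂(bornMeasure E (A ε))) 1 0 := by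
    have h := (hf.hasLineDerivAt β).sub_const μ₀
    rw [hβ] at h
    refine h.congr_of_eventuallyEq ?_
    filter_upwards [hint] with ε hε
    rw [hlaw, integral_sub hε (integrable_const _)]
    simp
  have hmain := abs_deriv_integral_le E (f := fun x => f x - μ₀) (k := t * (S / 2))
    (by positivity) (by rw [hlaw0]; exact hL2.sub (memLp_const _))
    (by
      filter_upwards [hint] with ε hε
      rw [hlaw]
      exact hε.sub (integrable_const _)) hlip hderiv
  rw [hlaw0, ← variance_eq_integral hL2.1.aemeasurable, abs_one] at hmain
  refine hmain.trans_eq ?_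
  ring

/-- The Cramér–Rao bound optimized over the direction. -/
theorem ofReal_gamma_sq_le_evariance (hN : 0 < N) {g : Fin m → Matrix (Fin N) (Fin N) ℂ}
    (hg : ∀ j, (g j).IsHermitian) {t : ℝ} (ht : 0 < t) {α : Fin m → ℝ}
    (hγ0 : 0 < gamma g α)
    (hγ : IsLeast ((fun β => opSeminorm (lincomb β g)) '' {β : Fin m → ℝ | α ⬝ᵥ β = 1})
        (gamma g α)⁻¹)
    (ρ : DensityMatrix (Fin N × Fin d))
    {U : (Fin m → ℝ) → Matrix (Fin N × Fin d) (Fin N × Fin d) ℂ} (hU : ControlledEvolution g t U)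
    (E : POVM X (Fin N × Fin d)) {f : X → ℝ} (hfm : Measurable f) {θ : Fin m → ℝ}
    (hf : IsLocallyUnbiased (outcomeLaw E ρ U) f α θ) :
    ENNReal.ofReal (gamma g α ^ 2 / t ^ 2) ≤ evariance f (outcomeLaw E ρ U θ) := by
  have hprob : IsProbabilityMeasure (outcomeLaw E ρ U θ) :=
    isProbabilityMeasure_outcomeLaw E ρ U θ (hU.mem_unitaryGroup hg θ)
  by_cases hL2 : MemLp f 2 (outcomeLaw E ρ U θ)
  · obtain ⟨β, hβ, hβγ⟩ := hγ.1
    have h := one_le_mul_sqrt_variance hN hg hβ ρ hU E hf hL2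
    dsimp only at hβγ
    rw [hβγ] at h
    rw [← hL2.ofReal_variance_eq]
    refine ENNReal.ofReal_le_ofReal ?_
    rw [← Real.sq_sqrt (variance_nonneg f (outcomeLaw E ρ U θ)), ← div_pow]
    refine pow_le_pow_left₀ (by positivity) ?_ 2
    rw [div_le_iff₀ ht]
    have h' := mul_le_mul_of_nonneg_left h hγ0.le
    rw [mul_one] at h'
    refine h'.trans_eq ?_
    field_simp
  · rw [evariance_eq_top hfm.aestronglyMeasurable hL2]
    exact le_top

end bound

end QMetrology

theorem mainTheorem1 {N m : ℕ} (g : Fin m → Matrix (Fin N) (Fin N) ℂ)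
    (hHerm : ∀ j, (g j).IsHermitian) (hTr : ∀ j, (g j).trace = 0)
    (hLin : LinearIndependent ℝ g) (α : Fin m → ℝ) (hα : α ≠ 0) (t : ℝ) (ht : 0 < t) :
    -- `γ(g|α)` is a positive minimum
    0 < gamma g α ∧
    IsLeast ((fun A => traceNorm A / 2) '' feasible g α) (gamma g α) ∧
    -- its inverse is the minimal seminorm of `β · g` subject to `α · β = 1`
    IsLeast ((fun β => opSeminorm (lincomb β g)) '' {β : Fin m → ℝ | α ⬝ᵥ β = 1})
      (gamma g α)⁻¹ ∧
    -- every feasible linear program has a minimum, and the smallest of these is `γ² / t²`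
    (∀ K, (lpFeasible g α K).Nonempty → ∃ v, IsLeast (lpValues g α t K) v) ∧
    IsLeast {v | ∃ K, IsLeast (lpValues g α t K) v} (gamma g α ^ 2 / t ^ 2) ∧
    -- the bound for all ancillas, initial states, controls, measurements and estimators
    (∀ (d : ℕ) (ρ : DensityMatrix (Fin N × Fin d))
      (U : (Fin m → ℝ) → Matrix (Fin N × Fin d) (Fin N × Fin d) ℂ)
      (_ : ControlledEvolution g t U)
      (X : Type*) [MeasurableSpace X] (E : POVM X (Fin N × Fin d))
      (f : X → ℝ) (_ : Measurable f) (θ : Fin m → ℝ)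
      (_ : IsLocallyUnbiased (outcomeLaw E ρ U) f α θ),
      ENNReal.ofReal (gamma g α ^ 2 / t ^ 2) ≤ evariance f (outcomeLaw E ρ U θ)) := by
  -- for `N = 0` all matrices vanish, so `m = 0` and `α = 0`
  have hN : 0 < N := by
    rcases Nat.eq_zero_or_pos N with rfl | h
    · obtain ⟨j, -⟩ := Function.ne_iff.mp hα
      exact absurd (Subsingleton.elim _ _) (hLin.ne_zero j)
    · exact h
  obtain ⟨h1, h2, h3⟩ := gamma_duality hN hHerm hTr hLin hα
  exact ⟨h1, h2, h3, fun K hK => exists_isLeast_lpValues ht K hK, isLeast_lpOptima h1.le h2,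
    fun d ρ U hU X _ E f hfm θ hf => ofReal_gamma_sq_le_evariance hN hHerm ht h1 h3 ρ hU E hfm hf⟩
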